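/- Let $A=\{0,1,2\}$ and let $A^{\mathbb N}$ ($\mathbb N=\{0,1,2,\dots\}$) carry the product topology and the $\sigma$-field $\mathcal B$ generated by the cylinders $[u]=\{x\in A^{\mathbb N}:x_i=u_i,\ 0\le i<|u|\}$, $u$ a finite word over $A$. Let $T$ be the shift, $(Tx)_i=x_{i+1}$. For $n\ge 1$ let $\omega_n=\max\{k\in\mathbb N: 2^k \text{ divides } n\}$. Let $u\mapsto u'$ be the letter-by-letter map on words that exchanges $1$ and $2$ and fixes $0$. Let $(b_n)_{n\ge1}$ be any sequence of powers of $2$ (that is, of numbers $2^k$, $k\in\mathbb N$) with $$\lim_{n\to\infty}\frac{b_{n+1}}{\prod_{i=1}^n b_i}=\infty .$$ Put $a_0=1$, $\mathcal A_0=\{1,2\}$ and, for $k\ge 0$, $a_{k+1}=2b_{k+1}a_k+2b_{k+1}-1$, and let $\mathcal A_{k+1}\subseteq A^{a_{k+1}}$ be the set of all words $$u(1)0^{\omega_1}u(2)0^{\omega_2}\cdots u(b_{k+1})0^{\omega_{b_{k+1}}}\,(u(1))'0^{\omega_{b_{k+1}+1}}(u(2))'0^{\omega_{b_{k+1}+2}}\cdots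 (u(b_{k+1}))'0^{\omega_{2b_{k+1}}},\qquad u(i)\in\mathcal A_k .$$ Then: (i) there is exactly one probability measure $\nu$ on $(A^{\mathbb N},\mathcal B)$ such that for every $k\ge 0$ and every word $u$ of length $a_k$, $\nu([u])=1/\#\mathcal A_k$ if $u\in\mathcal A_k$ and $\nu([u])=0$ otherwise; (ii) the Cesàro averages $\frac1n\sum_{i=0}^{n-1}T^i\nu$ (where $T^i\nu$ is the image of $\nu$ under $T^i$) converge weakly, as $n\to\infty$, to a probability measure $\mu$ on $(A^{\mathbb N},\mathcal B)$; (iii) $\mu$ is $T$-invariant and the system $(A^{\mathbb N},\mathcal B,\mu,T)$ is weakly mixing: for all $B,C\in\mathcal B$, $$\lim_{n\to\infty}\frac1n\sum_{j=1}^{n}\bigl|\mu(B\cap T^{-j}C)-\mu(B)\mu(C)\bigr|=0 .$$ -/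

import Mathlib

open MeasureTheory Filter Topology
open scoped NNReal ENNReal

namespace ZeroEntropyProcess

/-- The alphabet `{0, 1, 2}`. -/
abbrev Letter : Type := Fin 3

/-- The space of one-sided sequences over the alphabet, with the product topology and the
product σ-algebra (the σ-algebra generated by the cylinders). -/
abbrev Seq : Type := ℕ → Letter

/-- The shift `(T x)_i = x_{i+1}`. -/
def shift (x : Seq) : Seq := fun i => x (i + 1)

/-- `ω_n = max {k : 2 ^ k divides n}`, for `n ≥ 1`. -/
def omega (n : ℕ) : ℕ := padicValNat 2 n

/-- The negation on letters: it exchanges `1` and `2` and fixes `0`. -/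
def neg (c : Letter) : Letter := Equiv.swap 1 2 c

/-- The block `0^m`. -/
def zeros (m : ℕ) : List Letter := List.replicate m 0

/-- The word
`u(1) 0^{ω_1} ⋯ u(n) 0^{ω_n} (u(1))' 0^{ω_{n+1}} ⋯ (u(n))' 0^{ω_{2n}}`. -/
def concatWord (n : ℕ) (u : ℕ → List Letter) : List Letter :=
  (List.range' 1 n).flatMap (fun i => u i ++ zeros (omega i)) ++
    (List.range' 1 n).flatMap (fun i => (u i).map neg ++ zeros (omega (n + i)))

/-- The lengths: `a_0 = 1`, `a_{k+1} = 2 b_{k+1} a_k + 2 b_{k+1} - 1`. -/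
def wordLength (b : ℕ → ℕ) : ℕ → ℕ
  | 0 => 1
  | k + 1 => 2 * b (k + 1) * wordLength b k + (2 * b (k + 1) - 1)

/-- The families of words: `𝒜_0 = {1, 2}`, and `𝒜_{k+1}` consists of the words
`concatWord b_{k+1} u` with `u(1), …, u(b_{k+1}) ∈ 𝒜_k`. -/
def family (b : ℕ → ℕ) : ℕ → Set (List Letter)
  | 0 => {[1], [2]}
  | k + 1 => {w | ∃ u : ℕ → List Letter,
      (∀ i, 1 ≤ i → i ≤ b (k + 1) → u i ∈ family b k) ∧ w = concatWord (b (k + 1)) u}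

/-- The cylinder `[u]`. -/
def cylinder (u : List Letter) : Set Seq :=
  {x | ∀ (i : ℕ) (hi : i < u.length), x i = u[i]}

open Classical in
/-- `ν` has the prescribed values on the cylinders of length `a_k`, `k ≥ 0`: every word of `𝒜_k`
has mass `1 / #𝒜_k`, every other word of length `a_k` has mass `0`. -/
def HasCylinderValues (b : ℕ → ℕ) (ν : ProbabilityMeasure Seq) : Prop :=
  ∀ (k : ℕ) (u : List Letter), u.length = wordLength b k →
    (ν : Measure Seq) (cylinder u) =
      if u ∈ family b k then ((family b k).ncard : ℝ≥0∞)⁻¹ else 0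

/-- The Cesàro average `(1 / n) ∑_{i < n} T^i ν` (the zero measure if `n = 0`). -/
noncomputable def cesaro (ν : ProbabilityMeasure Seq) (n : ℕ) : FiniteMeasure Seq :=
  (n : ℝ≥0)⁻¹ • ∑ i ∈ Finset.range n, ν.toFiniteMeasure.map (shift^[i])

/-- Weak mixing of a probability-preserving system: `T` preserves `μ` and
`(1 / n) ∑_{j=1}^n |μ(B ∩ T^{-j} C) - μ(B) μ(C)| → 0` for all measurable `B`, `C`. -/
def IsWeaklyMixing {X : Type*} [MeasurableSpace X] (T : X → X) (μ : ProbabilityMeasure X) :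
    Prop :=
  MeasurePreserving T (μ : Measure X) (μ : Measure X) ∧
    ∀ B C : Set X, MeasurableSet B → MeasurableSet C →
      Tendsto (fun n : ℕ => (1 / (n : ℝ)) * ∑ j ∈ Finset.Icc 1 n,
        |(μ : Measure X).real (B ∩ T^[j] ⁻¹' C)
          - (μ : Measure X).real B * (μ : Measure X).real C|) atTop (𝓝 0)

end ZeroEntropyProcess

/-!
Write `s` for the binary digit sum. By Legendre's formula `ω_1 + ⋯ + ω_i = i - s(i)`, so that the
words of all the families have their `i`-th nonzero letter at the same position `2 i - s(i)`, and
consecutive words of `𝒜_k` inside a longer word are separated by `0^{ω_1}, 0^{ω_2}, …` again. The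
process is therefore the law of one explicit sequence `point b ξ`: its nonzero letters are read off
from independent fair bits `ξ`, the bit used in the `i`-th place being determined by the digits of
`i` in mixed radix `2 b_1, 2 b_2, …` (`slot`), and negated according to these digits (`flip`). The
words of `𝒜_k` correspond bijectively to their free bits, which gives the values on cylinders
(`hasCylinderValues_process`), and these determine the measure (`eq_process`).

For a function `f` of finitely many coordinates with values in `[0, 1]`, the positions inside the
blocks of one level give a lower bound for the lower limit of the Cesàro means. Applied to `f` and
to `1 - f` at ever higher levels this shows that they converge, and by compactness the Cesàro
averages of the process converge weakly (`exists_tendsto_cesaro`).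

For weak mixing, only an upper bound for the correlations at distance `j` is needed, up to a
small mean error in `j`: the bound for `g` and that for `1 - g` give both sides. Fix a level `k`.
Two positions in blocks `I` and `J` see independent words unless `I` and `J` have the same slot, and
such pairs are rare because the products of the `b_i` tend to infinity (`exists_card_slot_eq_le`).
In the independent case the correlation is governed by the frequency with which two blocks of level
`k` start at distance `d`. A window of `d`'s of length `R` contributes at most `R / a_k + 1`, so it
suffices that this frequency varies slowly with `d`. Blocks that are `D` apart start at distance
`2^e D - (s(I + D) - s(I))` with a constant `e`, so the question is whether the law of
`s(I + D) - s(I)`, for random `I`, is nearly invariant under translation by `1` for most `D`. The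
recursions for `D ↦ 2 D` and `D ↦ 2 D + 1` show that, in the limit, the mean over `D` of the total
variation distance between the law and its translate does not decrease when the law is convolved
with one more factor `(δ_0 + δ_1) / 2` (`EventuallyFlat.of_succ`); after convolution with many
factors it is small by Chebyshev's inequality (`exists_forall_smooth_le`).
-/

namespace ZeroEntropyProcess

open scoped symmDiff

variable {b : ℕ → ℕ}

/-! ### Binary digit sums and the positions of the nonzero letters -/

/-- The sum of the binary digits of `n`. -/
def digitSum (n : ℕ) : ℕ := (Nat.digits 2 n).sum

lemma digitSum_two_mul (n : ℕ) : digitSum (2 * n) = digitSum n := by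
  rcases Nat.eq_zero_or_pos n with rfl | hn
  · simp
  · have h := Nat.digits_add_two_add_one 0 (2 * n - 1)
    have e : 2 * n - 1 + 1 = 2 * n := by omega
    rw [e] at h
    unfold digitSum
    simp [h]

lemma digitSum_two_mul_add_one (n : ℕ) : digitSum (2 * n + 1) = digitSum n + 1 := by
  have h := Nat.digits_add_two_add_one 0 (2 * n)
  unfold digitSum
  rw [show (2 : ℕ) = 0 + 2 from rfl, h]
  simp [Nat.add_mod, show (2 * n + 1) / 2 = n by omega]
  omega

lemma digitSum_zero : digitSum 0 = 0 := by simp [digitSum]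

lemma digitSum_one : digitSum 1 = 1 := by simp [digitSum]

lemma digitSum_le (n : ℕ) : digitSum n ≤ n := Nat.digit_sum_le 2 n

lemma omega_add_digitSum (n : ℕ) : omega (n + 1) + digitSum (n + 1) = digitSum n + 1 := by
  induction n using Nat.strong_induction_on with
  | _ n ih =>
    rcases Nat.even_or_odd' n with ⟨m, rfl | rfl⟩
    · have : omega (2 * m + 1) = 0 := by
        unfold omega
        exact padicValNat.eq_zero_of_not_dvd (by omega)
      rw [this, digitSum_two_mul_add_one, digitSum_two_mul, zero_add]
    · have h : omega (2 * (m + 1)) = omega (m + 1) + 1 := by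
        unfold omega
        rw [padicValNat.mul (by norm_num) (by omega), padicValNat_self, add_comm]
      rw [show 2 * m + 1 + 1 = 2 * (m + 1) by ring, h, digitSum_two_mul, digitSum_two_mul_add_one]
      have := ih m (by omega)
      omega

lemma digitSum_mul_pow_add (e I l : ℕ) (hl : l < 2 ^ e) :
    digitSum (I * 2 ^ e + l) = digitSum I + digitSum l := by
  induction e generalizing l with
  | zero =>
    obtain rfl : l = 0 := by simpa using hl
    simp [digitSum_zero]
  | succ e ih =>
    rw [pow_succ] at hl
    rcases Nat.even_or_odd' l with ⟨m, rfl | rfl⟩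
    · rw [show I * 2 ^ (e + 1) + 2 * m = 2 * (I * 2 ^ e + m) by ring, digitSum_two_mul,
        digitSum_two_mul, ih m (by omega)]
    · rw [show I * 2 ^ (e + 1) + (2 * m + 1) = 2 * (I * 2 ^ e + m) + 1 by ring,
        digitSum_two_mul_add_one, digitSum_two_mul_add_one, ih m (by omega)]
      ring

/-- The position of the `i`-th nonzero letter (`i = 0, 1, …`) of a sequence of the process. By
Legendre's formula `ω_1 + ⋯ + ω_i` is `i` minus the binary digit sum of `i`. -/
def pos (i : ℕ) : ℕ := 2 * i - digitSum i

lemma pos_add_digitSum (i : ℕ) : pos i + digitSum i = 2 * i := by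
  have := digitSum_le i
  unfold pos; omega

lemma pos_zero : pos 0 = 0 := by simp [pos]

lemma pos_succ (i : ℕ) : pos (i + 1) = pos i + 1 + omega (i + 1) := by
  have h1 := pos_add_digitSum i
  have h2 := pos_add_digitSum (i + 1)
  have h3 := omega_add_digitSum i
  omega

lemma pos_strictMono : StrictMono pos :=
  strictMono_nat_of_lt_succ fun i => by have := pos_succ i; omega

lemma pos_mul_pow_add (e I l : ℕ) (hl : l < 2 ^ e) :
    pos (I * 2 ^ e + l) = pos (I * 2 ^ e) + pos l := by
  have h1 := pos_add_digitSum (I * 2 ^ e + l)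
  have h2 := pos_add_digitSum (I * 2 ^ e)
  have h3 := pos_add_digitSum l
  have h4 := digitSum_mul_pow_add e I l hl
  have h5 := digitSum_mul_pow_add e I 0 (by positivity)
  rw [add_zero, digitSum_zero, add_zero] at h5
  omega

lemma pos_mul_pow_add_digitSum (e I : ℕ) : pos (I * 2 ^ e) + digitSum I = 2 * 2 ^ e * I := by
  have h2 := pos_add_digitSum (I * 2 ^ e)
  have h5 := digitSum_mul_pow_add e I 0 (by positivity)
  rw [add_zero, digitSum_zero, add_zero] at h5
  rw [← h5, h2]; ring

/-! ### The words of the process as prefixes of one sequence -/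

/-- The number of nonzero letters of a word of `𝒜_k`. -/
def letterCount (b : ℕ → ℕ) (k : ℕ) : ℕ := ∏ i ∈ Finset.range k, (2 * b (i + 1))

/-- The number of letters that can be chosen freely in a word of `𝒜_k`. -/
def freeCount (b : ℕ → ℕ) (k : ℕ) : ℕ := ∏ i ∈ Finset.range k, b (i + 1)

lemma letterCount_succ (b : ℕ → ℕ) (k : ℕ) :
    letterCount b (k + 1) = letterCount b k * (2 * b (k + 1)) := Finset.prod_range_succ _ _

lemma freeCount_succ (b : ℕ → ℕ) (k : ℕ) :
    freeCount b (k + 1) = freeCount b k * b (k + 1) := Finset.prod_range_succ _ _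

lemma pos_of_isPow (hb : ∀ n : ℕ, 1 ≤ n → ∃ k : ℕ, b n = 2 ^ k) (n : ℕ) : 0 < b (n + 1) := by
  obtain ⟨e, he⟩ := hb (n + 1) (by omega)
  rw [he]; positivity

lemma letterCount_eq_pow (hb : ∀ n : ℕ, 1 ≤ n → ∃ k : ℕ, b n = 2 ^ k) (k : ℕ) :
    ∃ e, letterCount b k = 2 ^ e := by
  induction k with
  | zero => exact ⟨0, by simp [letterCount]⟩
  | succ k ih =>
    obtain ⟨e, he⟩ := ih
    obtain ⟨f, hf⟩ := hb (k + 1) (by omega)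
    exact ⟨e + (1 + f), by rw [letterCount_succ, he, hf, pow_add, pow_add, pow_one]⟩

lemma letterCount_pos (hb : ∀ n : ℕ, 1 ≤ n → ∃ k : ℕ, b n = 2 ^ k) (k : ℕ) :
    0 < letterCount b k := by
  obtain ⟨e, he⟩ := letterCount_eq_pow hb k
  rw [he]; positivity

lemma freeCount_pos (hb : ∀ n : ℕ, 1 ≤ n → ∃ k : ℕ, b n = 2 ^ k) (k : ℕ) :
    0 < freeCount b k := Finset.prod_pos fun i _ => pos_of_isPow hb i

lemma wordLength_add_one (hb : ∀ n : ℕ, 1 ≤ n → ∃ k : ℕ, b n = 2 ^ k) (k : ℕ) :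
    wordLength b k + 1 = 2 * letterCount b k := by
  induction k with
  | zero => simp [wordLength, letterCount]
  | succ k ih =>
    have h := pos_of_isPow hb k
    rw [letterCount_succ, wordLength]
    have : 2 * b (k + 1) * (wordLength b k + 1) = 2 * b (k + 1) * (2 * letterCount b k) := by
      rw [ih]
    have e : 2 * b (k + 1) * (wordLength b k + 1)
      = 2 * b (k + 1) * wordLength b k + 2 * b (k + 1) := by ring
    have e2 : 2 * (letterCount b k * (2 * b (k + 1))) = 2 * b (k + 1) * (2 * letterCount b k) := by
      ring
    omega

/-- The position at which the `I`-th word of `𝒜_k` starts in a sequence of the process. -/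
def blockPos (b : ℕ → ℕ) (k I : ℕ) : ℕ := pos (I * letterCount b k)

lemma blockPos_zero (b : ℕ → ℕ) (k : ℕ) : blockPos b k 0 = 0 := by simp [blockPos, pos_zero]

lemma blockPos_add_digitSum (hb : ∀ n : ℕ, 1 ≤ n → ∃ k : ℕ, b n = 2 ^ k) (k I : ℕ) :
    blockPos b k I + digitSum I = 2 * letterCount b k * I := by
  obtain ⟨e, he⟩ := letterCount_eq_pow hb k
  rw [blockPos, he, pos_mul_pow_add_digitSum]

lemma pos_letterCount (hb : ∀ n : ℕ, 1 ≤ n → ∃ k : ℕ, b n = 2 ^ k) (k : ℕ) :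
    pos (letterCount b k) = wordLength b k := by
  have h1 := wordLength_add_one hb k
  have h2 := blockPos_add_digitSum hb k 1
  rw [blockPos, one_mul, mul_one, digitSum_one] at h2
  omega

lemma blockPos_succ (hb : ∀ n : ℕ, 1 ≤ n → ∃ k : ℕ, b n = 2 ^ k) (k I : ℕ) :
    blockPos b k (I + 1) = blockPos b k I + wordLength b k + omega (I + 1) := by
  have h1 := blockPos_add_digitSum hb k I
  have h2 := blockPos_add_digitSum hb k (I + 1)
  have h3 := omega_add_digitSum I
  have h4 := wordLength_add_one hb k
  rw [mul_add, mul_one] at h2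
  omega

/-- The number, in the sequence of words of `𝒜_k` that are chosen freely, of the word that is
repeated or negated in the `I`-th place: the last digit `d` of `I` in radix `2 b_{k+1}` selects the
choice `d mod b_{k+1}` within a word of `𝒜_{k+1}`, and the other digits select the slot of this
word. -/
def slot (b : ℕ → ℕ) (k I : ℕ) : ℕ :=
  if I = 0 then 0 else I % b (k + 1) + b (k + 1) * slot b (k + 1) (I / (2 * b (k + 1)))
termination_by I
decreasing_by
  rcases Nat.eq_zero_or_pos (b (k + 1)) with h | h
  · simp [h]; omega
  · exact Nat.div_lt_self (by omega) (by omega)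

/-- Whether the word of `𝒜_k` in the `I`-th place is the negative of the word that was chosen for
its slot. -/
def flip (b : ℕ → ℕ) (k I : ℕ) : Bool :=
  if I = 0 then false else
    xor (decide (I / b (k + 1) % 2 = 1)) (flip b (k + 1) (I / (2 * b (k + 1))))
termination_by I
decreasing_by
  rcases Nat.eq_zero_or_pos (b (k + 1)) with h | h
  · simp [h]; omega
  · exact Nat.div_lt_self (by omega) (by omega)

lemma slot_zero (b : ℕ → ℕ) (k : ℕ) : slot b k 0 = 0 := by rw [slot]; simp

lemma flip_zero (b : ℕ → ℕ) (k : ℕ) : flip b k 0 = false := by rw [flip]; simp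

lemma slot_eq (b : ℕ → ℕ) (k I : ℕ) :
    slot b k I = I % b (k + 1) + b (k + 1) * slot b (k + 1) (I / (2 * b (k + 1))) := by
  by_cases h : I = 0
  · subst h; simp [slot_zero]
  · rw [slot, if_neg h]

lemma flip_eq (b : ℕ → ℕ) (k I : ℕ) :
    flip b k I = xor (decide (I / b (k + 1) % 2 = 1)) (flip b (k + 1) (I / (2 * b (k + 1)))) := by
  by_cases h : I = 0
  · subst h; simp [flip_zero]
  · rw [flip, if_neg h]

lemma slot_mul_add (b : ℕ → ℕ) (k I d : ℕ) (hd : d < 2 * b (k + 1)) :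
    slot b k (I * (2 * b (k + 1)) + d) = d % b (k + 1) + b (k + 1) * slot b (k + 1) I := by
  rw [slot_eq, show I * (2 * b (k + 1)) + d = d + 2 * b (k + 1) * I by ring,
    Nat.add_mul_div_left _ _ (by omega), Nat.div_eq_of_lt hd, zero_add,
    show d + 2 * b (k + 1) * I = d + b (k + 1) * (2 * I) by ring, Nat.add_mul_mod_self_left]

lemma flip_mul_add (b : ℕ → ℕ) (k I d : ℕ) (hd : d < 2 * b (k + 1)) :
    flip b k (I * (2 * b (k + 1)) + d) = xor (decide (b (k + 1) ≤ d)) (flip b (k + 1) I) := by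
  have h0 : 0 < b (k + 1) := by omega
  rw [flip_eq, show I * (2 * b (k + 1)) + d = d + 2 * b (k + 1) * I by ring,
    Nat.add_mul_div_left _ _ (by omega), Nat.div_eq_of_lt hd, zero_add,
    show d + 2 * b (k + 1) * I = d + b (k + 1) * (2 * I) by ring,
    Nat.add_mul_div_left _ _ h0, Nat.add_mul_mod_self_left]
  congr 2
  rw [eq_iff_iff]
  by_cases h : b (k + 1) ≤ d
  · have : d / b (k + 1) = 1 := Nat.div_eq_of_lt_le (by omega) (by omega)
    simp [this, h]
  · have : d / b (k + 1) = 0 := Nat.div_eq_of_lt (by omega)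
    simp [this, h]

lemma slot_of_lt (b : ℕ → ℕ) (k d : ℕ) (hd : d < 2 * b (k + 1)) :
    slot b k d = d % b (k + 1) := by
  simpa [slot_zero] using slot_mul_add b k 0 d hd

lemma flip_of_lt (b : ℕ → ℕ) (k d : ℕ) (hd : d < 2 * b (k + 1)) :
    flip b k d = decide (b (k + 1) ≤ d) := by
  simpa [flip_zero] using flip_mul_add b k 0 d hd

lemma slot_flip_letterCount (b : ℕ → ℕ) (k I l : ℕ) (hl : l < letterCount b k) :
    slot b 0 (I * letterCount b k + l) = freeCount b k * slot b k I + slot b 0 l ∧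
    flip b 0 (I * letterCount b k + l) = xor (flip b k I) (flip b 0 l) := by
  induction k generalizing I l with
  | zero =>
    obtain rfl : l = 0 := by simpa [letterCount] using hl
    simp [letterCount, freeCount, slot_zero, flip_zero]
  | succ k ih =>
    rw [letterCount_succ] at hl
    have hE : 0 < letterCount b k := Nat.pos_of_ne_zero fun h => by simp [h] at hl
    set d := l / letterCount b k with hd
    set l' := l % letterCount b k with hl'
    have hl'' : l' < letterCount b k := Nat.mod_lt _ hE
    have hdl : l = d * letterCount b k + l' := by
      rw [hd, hl', mul_comm]; exact (Nat.div_add_mod _ _).symm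
    have hd2 : d < 2 * b (k + 1) := Nat.div_lt_of_lt_mul hl
    have e : I * letterCount b (k + 1) + l
        = (I * (2 * b (k + 1)) + d) * letterCount b k + l' := by
      rw [letterCount_succ, hdl]; ring
    obtain ⟨h1, h2⟩ := ih (I * (2 * b (k + 1)) + d) l' hl''
    obtain ⟨h3, h4⟩ := ih d l' hl''
    rw [e, h1, h2, hdl, h3, h4, slot_mul_add b k I d hd2, flip_mul_add b k I d hd2,
      slot_of_lt b k d hd2, flip_of_lt b k d hd2, freeCount_succ]
    constructor
    · ring
    · cases flip b (k + 1) I <;> cases flip b 0 l' <;> cases decide (b (k + 1) ≤ d) <;> rfl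

lemma slot_lt_freeCount (b : ℕ → ℕ) (k l : ℕ) (hl : l < letterCount b k) :
    slot b 0 l < freeCount b k := by
  induction k generalizing l with
  | zero =>
    obtain rfl : l = 0 := by simpa [letterCount] using hl
    simp [freeCount, slot_zero]
  | succ k ih =>
    rw [letterCount_succ] at hl
    have hE : 0 < letterCount b k := Nat.pos_of_ne_zero fun h => by simp [h] at hl
    have hl'' : l % letterCount b k < letterCount b k := Nat.mod_lt _ hE
    have hd2 : l / letterCount b k < 2 * b (k + 1) := Nat.div_lt_of_lt_mul hl
    have h1 := (slot_flip_letterCount b k (l / letterCount b k) (l % letterCount b k) hl'').1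
    rw [mul_comm (l / _), Nat.div_add_mod, slot_of_lt b k _ hd2] at h1
    have h2 := ih _ hl''
    have h0 : 0 < b (k + 1) := Nat.pos_of_ne_zero fun h => by simp [h] at hl
    have h3 : (l / letterCount b k) % b (k + 1) + 1 ≤ b (k + 1) := Nat.mod_lt _ h0
    have h4 := Nat.mul_le_mul_left (freeCount b k) h3
    rw [h1, freeCount_succ]
    linarith [mul_add (freeCount b k) ((l / letterCount b k) % b (k + 1)) 1]

/-- Every free letter of a word of `𝒜_k` is displayed somewhere in it. -/
lemma exists_slot_eq (hb : ∀ n : ℕ, 1 ≤ n → ∃ k : ℕ, b n = 2 ^ k) (k p : ℕ)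
    (hp : p < freeCount b k) : ∃ l < letterCount b k, slot b 0 l = p := by
  induction k generalizing p with
  | zero =>
    obtain rfl : p = 0 := by simpa [freeCount] using hp
    exact ⟨0, by simp [letterCount], slot_zero _ _⟩
  | succ k ih =>
    rw [freeCount_succ] at hp
    have hB := freeCount_pos hb k
    obtain ⟨l, hl, h⟩ := ih (p % freeCount b k) (Nat.mod_lt _ hB)
    have hd : p / freeCount b k < b (k + 1) := Nat.div_lt_of_lt_mul hp
    refine ⟨p / freeCount b k * letterCount b k + l, ?_, ?_⟩
    · rw [letterCount_succ]
      have : (p / freeCount b k + 1) * letterCount b k ≤ 2 * b (k + 1) * letterCount b k :=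
        Nat.mul_le_mul_right _ (by omega)
      calc p / freeCount b k * letterCount b k + l
          < p / freeCount b k * letterCount b k + letterCount b k := by omega
        _ = (p / freeCount b k + 1) * letterCount b k := by ring
        _ ≤ 2 * b (k + 1) * letterCount b k := this
        _ = _ := by ring
    · rw [(slot_flip_letterCount b k _ l hl).1, slot_of_lt b k _ (by omega), Nat.mod_eq_of_lt hd,
        h, Nat.div_add_mod]

/-- The nonzero letter that encodes a bit. -/
def letter (c : Bool) : Letter := if c then 1 else 2

lemma neg_letter (c : Bool) : neg (letter c) = letter (!c) := by cases c <;> decide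

lemma neg_zero : neg 0 = 0 := by decide

lemma letter_injective : Function.Injective letter := by
  intro c d; cases c <;> cases d <;> decide

open Classical in
/-- The sequence with free letters `ξ`: the `i`-th nonzero letter, at position `pos i`, shows the
free letter of its slot, negated or not; all other letters are `0`. -/
noncomputable def point (b : ℕ → ℕ) (ξ : ℕ → Bool) (t : ℕ) : Letter :=
  if h : ∃ i, pos i = t then letter (xor (flip b 0 h.choose) (ξ (slot b 0 h.choose))) else 0

lemma point_pos (b : ℕ → ℕ) (ξ : ℕ → Bool) (i : ℕ) :
    point b ξ (pos i) = letter (xor (flip b 0 i) (ξ (slot b 0 i))) := by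
  have h : ∃ j, pos j = pos i := ⟨i, rfl⟩
  rw [point, dif_pos h, pos_strictMono.injective h.choose_spec]

lemma point_of_forall_ne (b : ℕ → ℕ) (ξ : ℕ → Bool) (t : ℕ) (h : ∀ i, pos i ≠ t) :
    point b ξ t = 0 := dif_neg (by simpa using h)

/-- The free letters, relative to its own slot, of the `I`-th word of `𝒜_k` in `point b ξ`. -/
def blockChoice (b : ℕ → ℕ) (k I : ℕ) (ξ : ℕ → Bool) : ℕ → Bool :=
  fun p => xor (flip b k I) (ξ (freeCount b k * slot b k I + p))

lemma pos_mul_letterCount_add (hb : ∀ n : ℕ, 1 ≤ n → ∃ k : ℕ, b n = 2 ^ k) (k I l : ℕ)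
    (hl : l < letterCount b k) : pos (I * letterCount b k + l) = blockPos b k I + pos l := by
  obtain ⟨e, he⟩ := letterCount_eq_pow hb k
  rw [blockPos, he]
  exact pos_mul_pow_add e I l (he ▸ hl)

/-- If position `blockPos b k I + r` carries a nonzero letter and lies before the next block, this
letter is one of the letters of the `I`-th word of `𝒜_k`. -/
lemma exists_pos_eq_of_pos_eq (hb : ∀ n : ℕ, 1 ≤ n → ∃ k : ℕ, b n = 2 ^ k) (k I r i : ℕ)
    (hr : blockPos b k I + r < blockPos b k (I + 1)) (hi : pos i = blockPos b k I + r) :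
    ∃ l < letterCount b k, i = I * letterCount b k + l ∧ pos l = r := by
  have h1 : I * letterCount b k ≤ i := by
    rw [← pos_strictMono.le_iff_le, hi]; exact Nat.le_add_right _ _
  have h2 : i < (I + 1) * letterCount b k := by
    rw [← pos_strictMono.lt_iff_lt, hi]; exact hr
  have h3 : i = I * letterCount b k + (i - I * letterCount b k) := by omega
  have h4 : i - I * letterCount b k < letterCount b k := by
    rw [add_mul, one_mul] at h2; omega
  refine ⟨_, h4, h3, ?_⟩
  have := pos_mul_letterCount_add hb k I _ h4
  rw [← h3] at this
  omega

/-- The `I`-th word of `𝒜_k` in `point b ξ` is the initial word of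
`point b (blockChoice b k I ξ)`. -/
lemma point_blockPos_add (hb : ∀ n : ℕ, 1 ≤ n → ∃ k : ℕ, b n = 2 ^ k) (k I r : ℕ)
    (ξ : ℕ → Bool) (hr : r < wordLength b k) :
    point b ξ (blockPos b k I + r) = point b (blockChoice b k I ξ) r := by
  by_cases h : ∃ l, pos l = r
  · obtain ⟨l, rfl⟩ := h
    have hl : l < letterCount b k := by
      rwa [← pos_letterCount hb, pos_strictMono.lt_iff_lt] at hr
    obtain ⟨h1, h2⟩ := slot_flip_letterCount b k I l hl
    rw [← pos_mul_letterCount_add hb k I l hl, point_pos, point_pos, h1, h2, blockChoice]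
    congr 1
    cases flip b k I <;> cases flip b 0 l <;> simp
  · rw [point_of_forall_ne b _ r (by simpa using h), point_of_forall_ne]
    intro i hi
    obtain ⟨l, -, -, hl⟩ := exists_pos_eq_of_pos_eq hb k I r i
      (by have := blockPos_succ hb k I; omega) hi
    exact h ⟨l, hl⟩

lemma point_gap (hb : ∀ n : ℕ, 1 ≤ n → ∃ k : ℕ, b n = 2 ^ k) (k I r : ℕ)
    (ξ : ℕ → Bool) (hr : wordLength b k ≤ r) (hr' : blockPos b k I + r < blockPos b k (I + 1)) :
    point b ξ (blockPos b k I + r) = 0 := by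
  refine point_of_forall_ne _ _ _ fun i hi => ?_
  obtain ⟨l, hl, -, h⟩ := exists_pos_eq_of_pos_eq hb k I r i hr' hi
  have := pos_strictMono hl
  rw [pos_letterCount hb] at this
  omega

lemma point_congr (hb : ∀ n : ℕ, 1 ≤ n → ∃ k : ℕ, b n = 2 ^ k) (k r : ℕ) {ξ ξ' : ℕ → Bool}
    (h : ∀ p < freeCount b k, ξ p = ξ' p) (hr : r < wordLength b k) :
    point b ξ r = point b ξ' r := by
  by_cases hl : ∃ l, pos l = r
  · obtain ⟨l, rfl⟩ := hl
    have hl : l < letterCount b k := by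
      rwa [← pos_letterCount hb, pos_strictMono.lt_iff_lt] at hr
    rw [point_pos, point_pos, h _ (slot_lt_freeCount b k l hl)]
  · rw [point_of_forall_ne b _ r (by simpa using hl), point_of_forall_ne b _ r (by simpa using hl)]

/-- The initial word of `𝒜_k` of `point b ξ` determines the free letters that it shows. -/
lemma eq_of_point_eq (hb : ∀ n : ℕ, 1 ≤ n → ∃ k : ℕ, b n = 2 ^ k) (k : ℕ) {ξ ξ' : ℕ → Bool}
    (h : ∀ r < wordLength b k, point b ξ r = point b ξ' r) (p : ℕ) (hp : p < freeCount b k) :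
    ξ p = ξ' p := by
  obtain ⟨l, hl, rfl⟩ := exists_slot_eq hb k p hp
  have := h (pos l) (by rw [← pos_letterCount hb]; exact pos_strictMono hl)
  rw [point_pos, point_pos] at this
  simpa using letter_injective this

lemma neg_point (b : ℕ → ℕ) (ξ : ℕ → Bool) (t : ℕ) :
    neg (point b ξ t) = point b (fun p => !ξ p) t := by
  by_cases h : ∃ i, pos i = t
  · obtain ⟨i, rfl⟩ := h
    rw [point_pos, point_pos, neg_letter]
    congr 1
    cases flip b 0 i <;> simp
  · rw [point_of_forall_ne b _ t (by simpa using h), point_of_forall_ne b _ t (by simpa using h),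
      neg_zero]

/-! ### The families as sets of initial words -/

/-- The initial word of length `n` of a sequence. -/
def initialWord (x : Seq) (n : ℕ) : List Letter := (List.range n).map x

lemma initialWord_length (x : Seq) (n : ℕ) : (initialWord x n).length = n := by
  simp [initialWord]

lemma initialWord_eq_iff {x y : Seq} {n : ℕ} :
    initialWord x n = initialWord y n ↔ ∀ r < n, x r = y r := by
  simp [initialWord]

lemma initialWord_add (x : Seq) (m n : ℕ) :
    initialWord x (m + n) = initialWord x m ++ initialWord (fun r => x (m + r)) n := by
  simp [initialWord, List.range_add, Function.comp_def]

lemma initialWord_blockPos (hb : ∀ n : ℕ, 1 ≤ n → ∃ k : ℕ, b n = 2 ^ k) (k n : ℕ) (ξ : ℕ → Bool) :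
    initialWord (point b ξ) (blockPos b k n) = (List.range n).flatMap fun I =>
      initialWord (point b (blockChoice b k I ξ)) (wordLength b k) ++ zeros (omega (I + 1)) := by
  induction n with
  | zero => simp [blockPos_zero, initialWord]
  | succ n ih =>
    have h1 : initialWord (fun r => point b ξ (blockPos b k n + r)) (wordLength b k)
        = initialWord (point b (blockChoice b k n ξ)) (wordLength b k) :=
      initialWord_eq_iff.2 fun r hr => point_blockPos_add hb k n r ξ hr
    have h2 : initialWord (fun r => point b ξ (blockPos b k n + wordLength b k + r))
        (omega (n + 1)) = zeros (omega (n + 1)) := by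
      rw [zeros, List.eq_replicate_iff]
      refine ⟨initialWord_length _ _, fun c hc => ?_⟩
      simp only [initialWord, List.mem_map, List.mem_range] at hc
      obtain ⟨r, hr, rfl⟩ := hc
      rw [add_assoc]
      exact point_gap hb k n _ ξ (by omega) (by have := blockPos_succ hb k n; omega)
    rw [List.range_succ, List.flatMap_append, ← ih, blockPos_succ hb, initialWord_add,
      initialWord_add, h1, h2]
    simp

lemma concatWord_eq (n : ℕ) (u : ℕ → List Letter) :
    concatWord n u = (List.range (2 * n)).flatMap fun I =>
      (if n ≤ I then (u (I - n + 1)).map neg else u (I + 1)) ++ zeros (omega (I + 1)) := by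
  rw [concatWord, two_mul, List.range_add, List.flatMap_append, List.range'_eq_map_range,
    List.flatMap_map, List.flatMap_map, List.flatMap_map]
  congr 1
  · apply List.flatMap_congr
    intro I hI
    rw [if_neg (by simpa using hI), add_comm]
  · apply List.flatMap_congr
    intro I hI
    simp only [le_add_iff_nonneg_right, zero_le, if_true, Nat.add_sub_cancel_left]
    rw [add_comm 1 I, add_assoc]

lemma concatWord_congr (n : ℕ) {u v : ℕ → List Letter} (h : ∀ i, 1 ≤ i → i ≤ n → u i = v i) :
    concatWord n u = concatWord n v := by
  rw [concatWord_eq, concatWord_eq]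
  apply List.flatMap_congr
  intro I hI
  rw [List.mem_range] at hI
  split_ifs with hn
  · rw [h _ (by omega) (by omega)]
  · rw [h _ (by omega) (by omega)]

lemma concatWord_initialWord (hb : ∀ n : ℕ, 1 ≤ n → ∃ k : ℕ, b n = 2 ^ k) (k : ℕ)
    (ξ : ℕ → Bool) :
    concatWord (b (k + 1)) (fun i => initialWord (point b fun p => ξ (freeCount b k * (i - 1) + p))
      (wordLength b k)) = initialWord (point b ξ) (wordLength b (k + 1)) := by
  have e : wordLength b (k + 1) = blockPos b k (2 * b (k + 1)) := by
    rw [← pos_letterCount hb, letterCount_succ, blockPos, mul_comm]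
  rw [e, initialWord_blockPos hb, concatWord_eq]
  apply List.flatMap_congr
  intro I hI
  rw [List.mem_range] at hI
  congr 1
  split_ifs with h
  · have h1 : slot b k I = I - b (k + 1) := by
      rw [slot_of_lt b k I hI, Nat.mod_eq_sub_mod h, Nat.mod_eq_of_lt (by omega)]
    have h2 : flip b k I = true := by simpa [flip_of_lt b k I hI] using h
    unfold blockChoice
    rw [h1, h2]
    simp [initialWord, neg_point]
  · have h1 : slot b k I = I := by
      rw [slot_of_lt b k I hI, Nat.mod_eq_of_lt (by omega)]
    have h2 : flip b k I = false := by simpa [flip_of_lt b k I hI] using h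
    unfold blockChoice
    rw [h1, h2]
    simp

/-- The words of `𝒜_k` are the initial words of length `a_k` of the sequences `point b ξ`. -/
lemma mem_family_iff (hb : ∀ n : ℕ, 1 ≤ n → ∃ k : ℕ, b n = 2 ^ k) (k : ℕ) (w : List Letter) :
    w ∈ family b k ↔ ∃ ξ : ℕ → Bool, w = initialWord (point b ξ) (wordLength b k) := by
  induction k generalizing w with
  | zero =>
    have h (ξ : ℕ → Bool) : initialWord (point b ξ) (wordLength b 0) = [letter (ξ 0)] := by
      have := point_pos b ξ 0
      rw [pos_zero, flip_zero, slot_zero] at this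
      simp [initialWord, wordLength, this]
    simp only [h, family, Set.mem_insert_iff, Set.mem_singleton_iff]
    constructor
    · rintro (rfl | rfl)
      · exact ⟨fun _ => true, rfl⟩
      · exact ⟨fun _ => false, rfl⟩
    · rintro ⟨ξ, rfl⟩
      cases ξ 0
      · right; rfl
      · left; rfl
  | succ k ih =>
    simp only [family, Set.mem_ofPred_eq]
    have hB := freeCount_pos hb k
    constructor
    · rintro ⟨u, hu, rfl⟩
      have : ∀ i, ∃ ζ : ℕ → Bool, 1 ≤ i → i ≤ b (k + 1) →
          u i = initialWord (point b ζ) (wordLength b k) := by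
        intro i
        by_cases hi : 1 ≤ i ∧ i ≤ b (k + 1)
        · obtain ⟨ζ, hζ⟩ := (ih _).1 (hu i hi.1 hi.2)
          exact ⟨ζ, fun _ _ => hζ⟩
        · exact ⟨fun _ => true, fun h1 h2 => absurd ⟨h1, h2⟩ hi⟩
      choose ζ hζ using this
      refine ⟨fun n => ζ (n / freeCount b k + 1) (n % freeCount b k), ?_⟩
      rw [← concatWord_initialWord hb]
      refine concatWord_congr _ fun i h1 h2 => ?_
      rw [hζ i h1 h2, initialWord_eq_iff]
      intro r hr
      refine point_congr hb k r (fun p hp => ?_) hr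
      rw [Nat.mul_add_div hB, Nat.mul_add_mod, Nat.div_eq_of_lt hp, Nat.mod_eq_of_lt hp, add_zero,
        Nat.sub_add_cancel h1]
    · rintro ⟨ξ, rfl⟩
      exact ⟨_, fun i _ _ => (ih _).2 ⟨_, rfl⟩, (concatWord_initialWord hb k ξ).symm⟩

lemma ncard_family (hb : ∀ n : ℕ, 1 ≤ n → ∃ k : ℕ, b n = 2 ^ k) (k : ℕ) :
    (family b k).ncard = 2 ^ freeCount b k := by
  have hB := freeCount_pos hb k
  let F : (Fin (freeCount b k) → Bool) → List Letter := fun ζ =>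
    initialWord (point b fun p => ζ ⟨p % freeCount b k, Nat.mod_lt _ hB⟩) (wordLength b k)
  have hF : Function.Injective F := by
    intro ζ ζ' h
    have := eq_of_point_eq hb k (initialWord_eq_iff.1 h)
    funext p
    simpa [Nat.mod_eq_of_lt p.2] using this p p.2
  have hr : family b k = Set.range F := by
    ext w
    rw [mem_family_iff hb, Set.mem_range]
    constructor
    · rintro ⟨ξ, rfl⟩
      refine ⟨fun p => ξ p, initialWord_eq_iff.2 fun r hr => point_congr hb k r (fun p hp => ?_) hr⟩
      simp [Nat.mod_eq_of_lt hp]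
    · rintro ⟨ζ, rfl⟩
      exact ⟨_, rfl⟩
  rw [hr, ← Set.image_univ, Set.ncard_image_of_injective _ hF, Set.ncard_univ]
  simp

lemma mem_cylinder_initialWord {x y : Seq} {n : ℕ} :
    x ∈ cylinder (initialWord y n) ↔ ∀ r < n, x r = y r := by
  simp [cylinder, initialWord]

lemma cylinder_eq (u : List Letter) : cylinder u = {x | initialWord x u.length = u} := by
  ext x
  simp only [cylinder, Set.mem_ofPred_eq]
  constructor
  · intro h
    refine List.ext_getElem (initialWord_length _ _) fun i h1 h2 => ?_
    simpa [initialWord] using h i h2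
  · intro h i hi
    have : (initialWord x u.length)[i]'(by rwa [initialWord_length]) = u[i] := by
      simp only [h]
    rw [← this]
    simp [initialWord]

lemma wordLength_strictMono (hb : ∀ n : ℕ, 1 ≤ n → ∃ k : ℕ, b n = 2 ^ k) :
    StrictMono (wordLength b) :=
  strictMono_nat_of_lt_succ fun k => by
    have h := pos_of_isPow hb k
    rw [wordLength]
    have := Nat.mul_le_mul_right (wordLength b k) (show 1 ≤ 2 * b (k + 1) by omega)
    omega

lemma measurable_initialWord (n : ℕ) (u : List Letter) :
    MeasurableSet {x : Seq | initialWord x n = u} := by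
  by_cases h : u.length = n
  · subst h
    rw [← cylinder_eq]
    have : cylinder u = ⋂ (i : ℕ) (hi : i < u.length), (fun x : Seq => x i) ⁻¹' {u[i]} := by
      ext x; simp [cylinder]
    rw [this]
    exact MeasurableSet.iInter fun i => MeasurableSet.iInter fun hi =>
      measurable_pi_apply i (measurableSet_singleton _)
  · convert MeasurableSet.empty
    ext x
    simp only [Set.mem_ofPred_eq, Set.mem_empty_iff_false, iff_false]
    rintro rfl
    exact h (initialWord_length _ _)

lemma measurableSet_cylinder (u : List Letter) : MeasurableSet (cylinder u) := by
  rw [cylinder_eq]; exact measurable_initialWord _ _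

/-- A probability measure is determined by the masses of the cylinders whose lengths are the terms
of an unbounded sequence. -/
lemma measure_ext_of_cylinder {μ ν : Measure Seq} [IsProbabilityMeasure μ] [IsProbabilityMeasure ν]
    {a : ℕ → ℕ} (ha : ∀ q, ∃ k, q ≤ a k)
    (h : ∀ k (u : List Letter), u.length = a k → μ (cylinder u) = ν (cylinder u)) : μ = ν := by
  refine ext_of_generate_finite (measurableCylinders fun _ : ℕ => Letter)
    generateFrom_measurableCylinders.symm isPiSystem_measurableCylinders ?_ (by simp)
  intro s hs
  rw [measurableCylinders_nat] at hs
  simp only [Set.mem_iUnion, Set.mem_singleton_iff] at hs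
  obtain ⟨q, S, hS, rfl⟩ := hs
  obtain ⟨k, hk⟩ := ha (q + 1)
  -- the event is a finite disjoint union of cylinders of length `a k`
  let W : Set (List Letter) := {u | u.length = a k ∧ ∃ x ∈ MeasureTheory.cylinder (Finset.Iic q) S,
    u = initialWord x (a k)}
  have hW : W.Finite := (List.finite_length_eq Letter (a k)).subset fun u hu => hu.1
  have e : MeasureTheory.cylinder (Finset.Iic q) S = ⋃ u ∈ W, cylinder u := by
    ext x
    simp only [Set.mem_iUnion]
    constructor
    · intro hx
      exact ⟨initialWord x (a k), ⟨initialWord_length _ _, x, hx, rfl⟩,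
        mem_cylinder_initialWord.2 fun _ _ => rfl⟩
    · rintro ⟨u, ⟨-, y, hy, rfl⟩, hx⟩
      rw [mem_cylinder_initialWord] at hx
      rw [mem_cylinder] at hy ⊢
      convert hy using 1
      funext i
      have := Finset.mem_Iic.1 i.2
      exact hx i (by omega)
  have hd : W.PairwiseDisjoint cylinder := by
    intro u hu v hv huv
    refine Set.disjoint_left.2 fun x hxu hxv => huv ?_
    rw [cylinder_eq] at hxu hxv
    simp only [Set.mem_ofPred_eq, hu.1, hv.1] at hxu hxv
    rw [← hxu, hxv]
  rw [e, measure_biUnion hW.countable hd fun u _ => measurableSet_cylinder u,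
    measure_biUnion hW.countable hd fun u _ => measurableSet_cylinder u]
  exact tsum_congr fun u => h k u u.2.1

/-! ### The measure on sequences with independent fair free letters -/

/-- The law of a fair bit. -/
noncomputable def fairBit : Measure Bool := (PMF.uniformOfFintype Bool).toMeasure

instance : IsProbabilityMeasure fairBit := PMF.toMeasure.isProbabilityMeasure _

lemma fairBit_singleton (c : Bool) : fairBit {c} = 2⁻¹ := by
  rw [fairBit, PMF.toMeasure_apply_singleton _ _ (measurableSet_singleton c)]
  simp

lemma fairBit_map_xor (c : Bool) : fairBit.map (xor c) = fairBit := by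
  refine Measure.ext_of_singleton fun d => ?_
  rw [Measure.map_apply Measurable.of_discrete (measurableSet_singleton d), fairBit_singleton]
  have : xor c ⁻¹' {d} = {xor c d} := by
    ext e; cases c <;> cases d <;> cases e <;> simp
  rw [this, fairBit_singleton]

/-- The law of a sequence of independent fair bits. -/
noncomputable def coin : Measure (ℕ → Bool) := Measure.infinitePi fun _ => fairBit

instance : IsProbabilityMeasure coin := by unfold coin; infer_instance

lemma coin_agree (n : ℕ) (ζ : ℕ → Bool) : coin {ξ | ∀ p < n, ξ p = ζ p} = (2 ^ n)⁻¹ := by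
  have : {ξ : ℕ → Bool | ∀ p < n, ξ p = ζ p}
      = Set.pi (Finset.range n) fun p => ({ζ p} : Set Bool) := by
    ext ξ; simp [Set.mem_pi]
  rw [this, coin, Measure.infinitePi_pi _ fun _ _ => measurableSet_singleton _]
  simp [fairBit_singleton, ENNReal.inv_pow]

lemma measurePreserving_blockChoice (b : ℕ → ℕ) (k I : ℕ) :
    MeasurePreserving (blockChoice b k I) coin coin := by
  have h1 : Measurable fun (ξ : ℕ → Bool) p => ξ (freeCount b k * slot b k I + p) := by fun_prop
  have h2 : Measurable fun (ξ : ℕ → Bool) p => xor (flip b k I) (ξ p) :=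
    measurable_pi_lambda _ fun p =>
      (Measurable.of_discrete (f := xor (flip b k I))).comp (measurable_pi_apply p)
  have m1 : MeasurePreserving (fun (ξ : ℕ → Bool) p => ξ (freeCount b k * slot b k I + p))
      coin coin :=
    ⟨h1, Measure.map_infinitePi_infinitePi_of_inj (P := fun _ : ℕ => fairBit)
      (f := fun p => freeCount b k * slot b k I + p) (add_right_injective _)⟩
  have m2 : MeasurePreserving (fun (ξ : ℕ → Bool) p => xor (flip b k I) (ξ p)) coin coin := by
    refine ⟨h2, ?_⟩
    unfold coin
    rw [Measure.infinitePi_map_pi (μ := fun _ : ℕ => fairBit)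
      (f := fun _ => xor (flip b k I)) fun _ => Measurable.of_discrete]
    simp [fairBit_map_xor]
  exact m2.comp m1

lemma measurable_point (b : ℕ → ℕ) : Measurable (point b) := by
  refine measurable_pi_lambda _ fun t => ?_
  by_cases h : ∃ i, pos i = t
  · obtain ⟨i, rfl⟩ := h
    simp only [point_pos]
    exact (Measurable.of_discrete (f := fun c => letter (xor (flip b 0 i) c))).comp
      (measurable_pi_apply _)
  · simp only [point_of_forall_ne b _ t (by simpa using h)]
    exact measurable_const

/-- The law of `point b ξ` for independent fair bits `ξ`. -/
noncomputable def process (b : ℕ → ℕ) : ProbabilityMeasure Seq :=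
  ⟨coin.map (point b), Measure.isProbabilityMeasure_map (measurable_point b).aemeasurable⟩

lemma coe_process (b : ℕ → ℕ) : (process b : Measure Seq) = coin.map (point b) := rfl

lemma hasCylinderValues_process (hb : ∀ n : ℕ, 1 ≤ n → ∃ k : ℕ, b n = 2 ^ k) :
    HasCylinderValues b (process b) := by
  intro k u hu
  rw [coe_process, Measure.map_apply (measurable_point b) (measurableSet_cylinder u)]
  split_ifs with h
  · obtain ⟨ζ, rfl⟩ := (mem_family_iff hb k u).1 h
    have : point b ⁻¹' cylinder (initialWord (point b ζ) (wordLength b k))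
        = {ξ | ∀ p < freeCount b k, ξ p = ζ p} := by
      ext ξ
      rw [Set.mem_preimage, mem_cylinder_initialWord]
      exact ⟨fun h p hp => eq_of_point_eq hb k h p hp, fun h r hr => point_congr hb k r h hr⟩
    rw [this, coin_agree, ncard_family hb]
    simp
  · have : point b ⁻¹' cylinder u = ∅ := by
      rw [cylinder_eq, hu]
      ext ξ
      simp only [Set.mem_preimage, Set.mem_ofPred_eq, Set.mem_empty_iff_false, iff_false]
      intro e
      exact h ((mem_family_iff hb k u).2 ⟨ξ, e.symm⟩)
    rw [this, measure_empty]

lemma eq_process (hb : ∀ n : ℕ, 1 ≤ n → ∃ k : ℕ, b n = 2 ^ k) {ν : ProbabilityMeasure Seq}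
    (hν : HasCylinderValues b ν) : ν = process b := by
  refine Subtype.ext (@measure_ext_of_cylinder _ _ ν.2 (process b).2 (wordLength b)
    (fun q => ⟨q, (wordLength_strictMono hb).le_apply⟩) fun k u hu => ?_)
  exact (hν k u hu).trans (hasCylinderValues_process hb k u hu).symm

/-! ### Functions of finitely many coordinates -/

/-- `f x` depends only on the first `q` coordinates of `x`. -/
def IsLocal (q : ℕ) (f : Seq → ℝ) : Prop := ∀ x y : Seq, (∀ i < q, x i = y i) → f x = f y

lemma IsLocal.exists_eq {q : ℕ} {f : Seq → ℝ} (hf : IsLocal q f) :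
    ∃ F : (Fin q → Letter) → ℝ, f = fun x => F fun i => x i :=
  ⟨fun y => f fun i => if h : i < q then y ⟨i, h⟩ else 0, by
    funext x
    exact hf _ _ fun i hi => by simp [hi]⟩

lemma IsLocal.measurable {q : ℕ} {f : Seq → ℝ} (hf : IsLocal q f) : Measurable f := by
  obtain ⟨F, rfl⟩ := hf.exists_eq
  exact (Measurable.of_discrete (f := F)).comp (by fun_prop)

lemma IsLocal.continuous {q : ℕ} {f : Seq → ℝ} (hf : IsLocal q f) : Continuous f := by
  obtain ⟨F, rfl⟩ := hf.exists_eq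
  exact (continuous_of_discreteTopology (f := F)).comp (by fun_prop)

lemma IsLocal.mono {q q' : ℕ} {f : Seq → ℝ} (hf : IsLocal q f) (h : q ≤ q') : IsLocal q' f :=
  fun x y hxy => hf x y fun i hi => hxy i (hi.trans_le h)

lemma IsLocal.mul {q : ℕ} {f g : Seq → ℝ} (hf : IsLocal q f) (hg : IsLocal q g) :
    IsLocal q fun x => f x * g x := fun x y h => by
  simp only [hf x y h, hg x y h]

lemma IsLocal.one_sub {q : ℕ} {f : Seq → ℝ} (hf : IsLocal q f) :
    IsLocal q fun x => 1 - f x := fun x y h => by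
  simp only [hf x y h]

lemma shift_iterate (n : ℕ) (x : Seq) (i : ℕ) : shift^[n] x i = x (n + i) := by
  induction n generalizing x with
  | zero => simp
  | succ n ih => rw [Function.iterate_succ_apply, ih, shift]; congr 1; ring

lemma IsLocal.comp_shift {q : ℕ} {f : Seq → ℝ} (hf : IsLocal q f) (n : ℕ) :
    IsLocal (n + q) fun x => f (shift^[n] x) := fun x y h =>
  hf _ _ fun i hi => by rw [shift_iterate, shift_iterate, h _ (by omega)]

lemma measurable_shift : Measurable shift :=
  measurable_pi_lambda _ fun i => measurable_pi_apply (i + 1)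

/-! ### Expectations over the blocks of a random sequence -/

/-- The expectation of `f` at position `t` of the random sequence. -/
noncomputable def meanAt (b : ℕ → ℕ) (f : Seq → ℝ) (t : ℕ) : ℝ :=
  ∫ ξ, f (shift^[t] (point b ξ)) ∂coin

/-- Inside a block `f` sees the initial word of `point b (blockChoice b k I ξ)`. -/
lemma IsLocal.shift_blockPos_add (hb : ∀ n : ℕ, 1 ≤ n → ∃ k : ℕ, b n = 2 ^ k) {q : ℕ}
    {f : Seq → ℝ} (hf : IsLocal q f) {k r : ℕ} (hr : r + q ≤ wordLength b k) (I : ℕ)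
    (ξ : ℕ → Bool) : f (shift^[blockPos b k I + r] (point b ξ))
      = f (shift^[r] (point b (blockChoice b k I ξ))) :=
  hf _ _ fun i hi => by
    rw [shift_iterate, shift_iterate, add_assoc, point_blockPos_add hb k I _ ξ (by omega)]

lemma measurable_shift_point (b : ℕ → ℕ) (t : ℕ) :
    Measurable fun ξ : ℕ → Bool => shift^[t] (point b ξ) :=
  (measurable_shift.iterate t).comp (measurable_point b)

lemma meanAt_blockPos_add (hb : ∀ n : ℕ, 1 ≤ n → ∃ k : ℕ, b n = 2 ^ k) {q : ℕ}
    {f : Seq → ℝ} (hf : IsLocal q f) {k r : ℕ} (hr : r + q ≤ wordLength b k) (I : ℕ) :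
    meanAt b f (blockPos b k I + r) = meanAt b f r := by
  unfold meanAt
  simp only [hf.shift_blockPos_add hb hr]
  have h := measurePreserving_blockChoice b k I
  rw [← integral_map (φ := blockChoice b k I) (f := fun ξ => f (shift^[r] (point b ξ)))
    h.measurable.aemeasurable, h.map_eq]
  exact (hf.measurable.comp (measurable_shift_point b r)).aestronglyMeasurable

lemma integral_mul_of_disjoint_windows {B v w : ℕ} (hvw : v ≠ w) (F G : (ℕ → Bool) → ℝ)
    (hF : ∀ ξ ξ', (∀ p < B, ξ (B * v + p) = ξ' (B * v + p)) → F ξ = F ξ')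
    (hG : ∀ ξ ξ', (∀ p < B, ξ (B * w + p) = ξ' (B * w + p)) → G ξ = G ξ') :
    ∫ ξ, F ξ * G ξ ∂coin = (∫ ξ, F ξ ∂coin) * ∫ ξ, G ξ ∂coin := by
  have hind : ProbabilityTheory.iIndepFun (fun (i : ℕ) (ω : ℕ → Bool) => ω i) coin :=
    ProbabilityTheory.iIndepFun_infinitePi (X := fun _ x => x) fun _ => measurable_id
  let S : ℕ → Finset ℕ := fun v => Finset.Ico (B * v) (B * v + B)
  have key : ∀ v (F : (ℕ → Bool) → ℝ),
      (∀ ξ ξ', (∀ p < B, ξ (B * v + p) = ξ' (B * v + p)) → F ξ = F ξ') →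
      ∃ F' : (S v → Bool) → ℝ, F = fun ξ => F' fun i => ξ i := by
    intro v F hF
    refine ⟨fun y => F fun i => if h : i ∈ S v then y ⟨i, h⟩ else false, ?_⟩
    funext ξ
    refine hF _ _ fun p hp => ?_
    have : B * v + p ∈ S v := by simp [S, hp]
    simp [this]
  obtain ⟨F', rfl⟩ := key v F hF
  obtain ⟨G', rfl⟩ := key w G hG
  have hdisj : Disjoint (S v) (S w) := by
    rw [Finset.disjoint_left]
    intro i hi hi'
    simp only [S, Finset.mem_Ico] at hi hi'
    apply hvw
    rcases lt_trichotomy v w with h | h | h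
    · have := Nat.mul_le_mul_left B (show v + 1 ≤ w from h)
      rw [mul_add, mul_one] at this; omega
    · exact h
    · have := Nat.mul_le_mul_left B (show w + 1 ≤ v from h)
      rw [mul_add, mul_one] at this; omega
  have h := (hind.indepFun_finset (S v) (S w) hdisj fun i => measurable_pi_apply i).comp
    (Measurable.of_discrete (f := F')) (Measurable.of_discrete (f := G'))
  exact h.integral_fun_mul_eq_mul_integral
    ((Measurable.of_discrete (f := F')).comp (by fun_prop)).aestronglyMeasurable
    ((Measurable.of_discrete (f := G')).comp (by fun_prop)).aestronglyMeasurable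

/-- Words with different slots are independent. -/
lemma integral_mul_of_slot_ne (hb : ∀ n : ℕ, 1 ≤ n → ∃ k : ℕ, b n = 2 ^ k) {q : ℕ}
    {f g : Seq → ℝ} (hf : IsLocal q f) (hg : IsLocal q g) {k r r' : ℕ}
    (hr : r + q ≤ wordLength b k) (hr' : r' + q ≤ wordLength b k) {I J : ℕ}
    (hIJ : slot b k I ≠ slot b k J) :
    ∫ ξ, f (shift^[blockPos b k I + r] (point b ξ)) * g (shift^[blockPos b k J + r'] (point b ξ))
      ∂coin = meanAt b f r * meanAt b g r' := by
  rw [integral_mul_of_disjoint_windows (B := freeCount b k) hIJ, ← meanAt_blockPos_add hb hf hr I,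
    ← meanAt_blockPos_add hb hg hr' J]
  · rfl
  · intro ξ ξ' h
    rw [hf.shift_blockPos_add hb hr, hf.shift_blockPos_add hb hr]
    refine hf _ _ fun i hi => ?_
    rw [shift_iterate, shift_iterate]
    exact point_congr hb k _ (fun p hp => by rw [blockChoice, blockChoice, h p hp]) (by omega)
  · intro ξ ξ' h
    rw [hg.shift_blockPos_add hb hr', hg.shift_blockPos_add hb hr']
    refine hg _ _ fun i hi => ?_
    rw [shift_iterate, shift_iterate]
    exact point_congr hb k _ (fun p hp => by rw [blockChoice, blockChoice, h p hp]) (by omega)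

/-! ### Flatness of the increments of the digit sum -/

/-- The mean of `ψ (s(I + D) - s(I))` over `I < 2 ^ L`, where `s` is the binary digit sum. -/
noncomputable def avgIncr (L D : ℕ) (ψ : ℤ → ℝ) : ℝ :=
  (∑ I ∈ Finset.range (2 ^ L), ψ ((digitSum (I + D) : ℤ) - digitSum I)) / 2 ^ L

lemma avgIncr_add (L D : ℕ) (ψ φ : ℤ → ℝ) :
    avgIncr L D (fun x => ψ x + φ x) = avgIncr L D ψ + avgIncr L D φ := by
  simp only [avgIncr, Finset.sum_add_distrib, add_div]

lemma avgIncr_const_mul (L D : ℕ) (c : ℝ) (ψ : ℤ → ℝ) :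
    avgIncr L D (fun x => c * ψ x) = c * avgIncr L D ψ := by
  simp only [avgIncr, ← Finset.mul_sum, mul_div_assoc]

lemma abs_avgIncr_le (L D : ℕ) {ψ : ℤ → ℝ} {c : ℝ} (h : ∀ x, |ψ x| ≤ c) :
    |avgIncr L D ψ| ≤ c := by
  rw [avgIncr, abs_div, abs_of_pos (by positivity : (0 : ℝ) < 2 ^ L), div_le_iff₀ (by positivity)]
  refine (Finset.abs_sum_le_sum_abs _ _).trans ((Finset.sum_le_sum fun I _ => h _).trans ?_)
  simp [mul_comm]

lemma sum_range_two_mul (n : ℕ) (f : ℕ → ℝ) :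
    ∑ i ∈ Finset.range (2 * n), f i = ∑ i ∈ Finset.range n, (f (2 * i) + f (2 * i + 1)) := by
  induction n with
  | zero => simp
  | succ n ih =>
    rw [show 2 * (n + 1) = 2 * n + 1 + 1 by ring, Finset.sum_range_succ, Finset.sum_range_succ, ih,
      Finset.sum_range_succ]
    ring

lemma avgIncr_two_mul (L D : ℕ) (ψ : ℤ → ℝ) : avgIncr (L + 1) (2 * D) ψ = avgIncr L D ψ := by
  have h (I : ℕ) : ψ ((digitSum (2 * I + 2 * D) : ℤ) - digitSum (2 * I))
      + ψ ((digitSum (2 * I + 1 + 2 * D) : ℤ) - digitSum (2 * I + 1))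
      = 2 * ψ ((digitSum (I + D) : ℤ) - digitSum I) := by
    rw [show 2 * I + 2 * D = 2 * (I + D) by ring, show 2 * I + 1 + 2 * D = 2 * (I + D) + 1 by ring,
      digitSum_two_mul, digitSum_two_mul, digitSum_two_mul_add_one, digitSum_two_mul_add_one]
    push_cast
    rw [add_sub_add_right_eq_sub]
    ring
  rw [avgIncr, avgIncr, pow_succ, mul_comm _ 2, sum_range_two_mul,
    Finset.sum_congr rfl fun I _ => h I, ← Finset.mul_sum, pow_succ]
  field_simp

lemma avgIncr_two_mul_add_one (L D : ℕ) (ψ : ℤ → ℝ) : avgIncr (L + 1) (2 * D + 1) ψ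
    = (avgIncr L D (fun x => ψ (x + 1)) + avgIncr L (D + 1) (fun x => ψ (x - 1))) / 2 := by
  have h (I : ℕ) : ψ ((digitSum (2 * I + (2 * D + 1)) : ℤ) - digitSum (2 * I))
      + ψ ((digitSum (2 * I + 1 + (2 * D + 1)) : ℤ) - digitSum (2 * I + 1))
      = ψ ((digitSum (I + D) : ℤ) - digitSum I + 1)
        + ψ ((digitSum (I + (D + 1)) : ℤ) - digitSum I - 1) := by
    rw [show 2 * I + (2 * D + 1) = 2 * (I + D) + 1 by ring,
      show 2 * I + 1 + (2 * D + 1) = 2 * (I + (D + 1)) by ring,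
      digitSum_two_mul, digitSum_two_mul, digitSum_two_mul_add_one, digitSum_two_mul_add_one]
    push_cast
    congr 2 <;> ring
  rw [avgIncr, avgIncr, avgIncr, pow_succ, mul_comm _ 2, sum_range_two_mul,
    Finset.sum_congr rfl fun I _ => h I, Finset.sum_add_distrib, pow_succ]
  field_simp

/-- The function `((1 + τ) / 2) ^ a (1 - τ) ψ`, where `τ` is the translation `ψ ↦ ψ (· + 1)`. -/
noncomputable def smooth : ℕ → (ℤ → ℝ) → ℤ → ℝ
  | 0, ψ => fun x => ψ x - ψ (x + 1)
  | a + 1, ψ => fun x => (smooth a ψ x + smooth a ψ (x + 1)) / 2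

lemma smooth_translate (a : ℕ) (ψ : ℤ → ℝ) (n x : ℤ) :
    smooth a (fun y => ψ (y + n)) x = smooth a ψ (x + n) := by
  induction a generalizing x with
  | zero => simp only [smooth]; rw [add_right_comm]
  | succ a ih => simp only [smooth, ih]; rw [add_right_comm]

lemma abs_smooth_le_two (a : ℕ) {ψ : ℤ → ℝ} (h : ∀ x, |ψ x| ≤ 1) (x : ℤ) : |smooth a ψ x| ≤ 2 := by
  induction a generalizing x with
  | zero =>
    have h1 := abs_le.1 (h x)
    have h2 := abs_le.1 (h (x + 1))
    rw [smooth, abs_le]; constructor <;> linarith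
  | succ a ih =>
    have h1 := abs_le.1 (ih x)
    have h2 := abs_le.1 (ih (x + 1))
    rw [smooth, abs_le]; constructor <;> linarith

lemma two_pow_mul_smooth (a : ℕ) (ψ : ℤ → ℝ) (x : ℤ) : 2 ^ a * smooth a ψ x
    = ∑ k ∈ Finset.range (a + 1), (a.choose k : ℝ) * (ψ (x + k) - ψ (x + k + 1)) := by
  induction a generalizing x with
  | zero => simp [smooth]
  | succ a ih =>
    have h : (2 : ℝ) ^ (a + 1) * smooth (a + 1) ψ x
        = 2 ^ a * smooth a ψ x + 2 ^ a * smooth a ψ (x + 1) := by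
      simp only [smooth, pow_succ]; ring
    rw [h, ih, ih, Finset.sum_range_succ' _ (a + 1), Finset.sum_range_succ' _ a]
    have e : ∀ k ∈ Finset.range (a + 1), (((a + 1).choose (k + 1) : ℕ) : ℝ)
        * (ψ (x + (k + 1 : ℕ)) - ψ (x + (k + 1 : ℕ) + 1))
        = (a.choose k : ℝ) * (ψ (x + 1 + k) - ψ (x + 1 + k + 1))
          + (a.choose (k + 1) : ℝ) * (ψ (x + (k + 1 : ℕ)) - ψ (x + (k + 1 : ℕ) + 1)) := by
      intro k _
      rw [Nat.choose_succ_succ]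
      push_cast
      rw [show x + 1 + (k : ℤ) = x + (k + 1) by ring]
      ring
    rw [Finset.sum_congr rfl e, Finset.sum_add_distrib,
      Finset.sum_range_succ (fun k => (a.choose (k + 1) : ℝ) * _) a, Nat.choose_succ_self]
    simp only [Nat.choose_zero_right]
    push_cast
    ring

lemma mul_two_pow_mul_smooth (a : ℕ) (ψ : ℤ → ℝ) (x : ℤ) : (a + 1) * (2 ^ a * smooth a ψ x)
    = ∑ k ∈ Finset.range (a + 2), ((a + 1 : ℝ) - 2 * k) * ((a + 1).choose k : ℝ) * ψ (x + k) := by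
  have h1 : ∑ k ∈ Finset.range (a + 2), ((a + 1 : ℝ) - k) * ((a + 1).choose k : ℝ) * ψ (x + k)
      = ∑ k ∈ Finset.range (a + 1), ((a + 1) * (a.choose k : ℝ)) * ψ (x + k) := by
    rw [Finset.sum_range_succ]
    push_cast
    rw [sub_self, zero_mul, zero_mul, add_zero]
    refine Finset.sum_congr rfl fun k hk => ?_
    have hk : k ≤ a := by simpa [Nat.lt_succ_iff] using hk
    have h3 := Nat.choose_mul_succ_eq a k
    congr 1
    have h4 : ((a.choose k * (a + 1) : ℕ) : ℝ) = (((a + 1).choose k * (a + 1 - k) : ℕ) : ℝ) := by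
      rw [h3]
    rw [Nat.cast_mul, Nat.cast_mul, Nat.cast_sub (by omega)] at h4
    push_cast at h4
    linarith
  have h2 : ∑ k ∈ Finset.range (a + 2), (k : ℝ) * ((a + 1).choose k : ℝ) * ψ (x + k)
      = ∑ k ∈ Finset.range (a + 1), ((a + 1) * (a.choose k : ℝ)) * ψ (x + k + 1) := by
    rw [Finset.sum_range_succ']
    simp only [Nat.cast_zero, zero_mul, add_zero]
    refine Finset.sum_congr rfl fun k hk => ?_
    have h3 : (((a + 1) * a.choose k : ℕ) : ℝ) = (((a + 1).choose (k + 1) * (k + 1) : ℕ) : ℝ) := by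
      rw [← Nat.add_one_mul_choose_eq]
    push_cast at h3 ⊢
    rw [h3, ← add_assoc]
    ring
  rw [two_pow_mul_smooth, Finset.mul_sum]
  have h3 : ∀ k ∈ Finset.range (a + 2), ((a + 1 : ℝ) - 2 * k) * ((a + 1).choose k : ℝ) * ψ (x + k)
      = ((a + 1 : ℝ) - k) * ((a + 1).choose k : ℝ) * ψ (x + k)
        - (k : ℝ) * ((a + 1).choose k : ℝ) * ψ (x + k) := fun k _ => by ring
  rw [Finset.sum_congr rfl h3, Finset.sum_sub_distrib, h1, h2, ← Finset.sum_sub_distrib]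
  exact Finset.sum_congr rfl fun k _ => by ring

/-- The variance of the binomial distribution. -/
lemma sum_sq_mul_choose (n : ℕ) :
    ∑ k ∈ Finset.range (n + 1), ((n : ℝ) - 2 * k) ^ 2 * (n.choose k : ℝ) = (n : ℝ) * 2 ^ n := by
  have h := congrArg (Polynomial.eval (1 / 2 : ℝ)) (bernsteinPolynomial.variance ℝ n)
  simp only [Polynomial.eval_finsetSum, bernsteinPolynomial, Polynomial.eval_mul,
    Polynomial.eval_pow, Polynomial.eval_sub, Polynomial.eval_smul, Polynomial.eval_X,
    Polynomial.eval_natCast, Polynomial.eval_one] at h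
  have e : ∀ k ∈ Finset.range (n + 1), ((n : ℝ) - 2 * k) ^ 2 * (n.choose k : ℝ)
      = 4 * 2 ^ n * ((n • (1 / 2 : ℝ) - k) ^ 2
        * ((n.choose k : ℝ) * (1 / 2) ^ k * (1 - 1 / 2) ^ (n - k))) := by
    intro k hk
    have hk : k ≤ n := by simpa [Nat.lt_succ_iff] using hk
    have : (1 / 2 : ℝ) ^ k * (1 - 1 / 2) ^ (n - k) = (2 ^ n)⁻¹ := by
      rw [show (1 - 1 / 2 : ℝ) = 1 / 2 by norm_num, ← pow_add, Nat.add_sub_cancel' hk]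
      simp
    rw [mul_assoc (n.choose k : ℝ), this, nsmul_eq_mul]
    field_simp
    ring
  rw [Finset.sum_congr rfl e, ← Finset.mul_sum, h]
  simp
  ring

/-- A bounded function that has been averaged often by `(1 + τ) / 2` hardly changes under the
translation `τ`: the weights `|(a+1) - 2k| C(a+1, k)` have a small sum by Chebyshev's inequality. -/
lemma exists_forall_smooth_le {ε : ℝ} (hε : 0 < ε) :
    ∃ a, ∀ ψ : ℤ → ℝ, (∀ x, |ψ x| ≤ 1) → ∀ x, |smooth a ψ x| ≤ ε := by
  obtain ⟨a, ha⟩ := exists_nat_gt (4 / (ε * ε))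
  refine ⟨a, fun ψ hψ x => ?_⟩
  set n : ℝ := (a : ℝ) + 1 with hn
  have hn0 : 0 < n := by positivity
  have hna : 4 / (ε * ε) ≤ n := by rw [hn]; linarith
  have h1 : |(a + 1) * (2 ^ a * smooth a ψ x)| ≤ n * 2 ^ a * ε := by
    rw [mul_two_pow_mul_smooth]
    have h2 : ∀ k ∈ Finset.range (a + 2),
        |((a + 1 : ℝ) - 2 * k) * ((a + 1).choose k : ℝ) * ψ (x + k)|
        ≤ (n * ε / 4) * ((a + 1).choose k : ℝ)
          + (1 / (n * ε)) * ((n - 2 * k) ^ 2 * ((a + 1).choose k : ℝ)) := by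
      intro k _
      rw [abs_mul, abs_mul, Nat.abs_cast]
      have hy : |n - 2 * k| ≤ n * ε / 4 + (1 / (n * ε)) * (n - 2 * k) ^ 2 := by
        have hpos : 0 < n * ε := by positivity
        rw [← sq_abs (n - 2 * (k : ℝ))]
        set y := |n - 2 * (k : ℝ)|
        have : 0 ≤ (1 / (n * ε)) * (y - n * ε / 2) ^ 2 := by positivity
        have e : (1 / (n * ε)) * (y - n * ε / 2) ^ 2
            = n * ε / 4 + (1 / (n * ε)) * y ^ 2 - y := by field_simp; ring
        linarith
      calc |n - 2 * k| * ((a + 1).choose k : ℝ) * |ψ (x + k)|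
          ≤ |n - 2 * k| * ((a + 1).choose k : ℝ) * 1 :=
            mul_le_mul_of_nonneg_left (hψ _) (by positivity)
        _ ≤ (n * ε / 4 + (1 / (n * ε)) * (n - 2 * k) ^ 2) * ((a + 1).choose k : ℝ) := by
            rw [mul_one]; exact mul_le_mul_of_nonneg_right hy (by positivity)
        _ = _ := by ring
    refine (Finset.abs_sum_le_sum_abs _ _).trans ((Finset.sum_le_sum h2).trans ?_)
    rw [Finset.sum_add_distrib, ← Finset.mul_sum, ← Finset.mul_sum]
    have h3 := sum_sq_mul_choose (a + 1)
    push_cast at h3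
    rw [h3]
    have h4 : ∑ k ∈ Finset.range (a + 2), ((a + 1).choose k : ℝ) = 2 ^ (a + 1) := by
      exact_mod_cast Nat.sum_range_choose (a + 1)
    rw [h4, pow_succ, ← hn]
    have h5 : 4 ≤ n * (ε * ε) := (div_le_iff₀ (by positivity)).1 hna
    have h6 : (1 / (n * ε)) * (n * (2 ^ a * 2)) = 2 ^ a * (2 / ε) := by field_simp
    have h7 : 2 / ε ≤ n * ε / 2 := by
      rw [div_le_iff₀ hε]; linarith
    rw [h6]
    have := mul_le_mul_of_nonneg_left h7 (by positivity : (0 : ℝ) ≤ 2 ^ a)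
    linarith
  rw [← mul_assoc, abs_mul, abs_of_pos (by positivity : (0 : ℝ) < (a + 1) * 2 ^ a)] at h1
  exact le_of_mul_le_mul_left h1 (by positivity)

/-- `s` bounds the sum over `D < M` of the total variation norms of `((1 + τ) / 2) ^ a (1 - τ)`
applied to the law of `s(I + D) - s(I)`, `I` uniform below `2 ^ L`; the norms are expressed by
duality. -/
def VariationBound (a L M : ℕ) (s : ℝ) : Prop :=
  ∀ ψ : ℕ → ℤ → ℝ, (∀ D x, |ψ D x| ≤ 1) →
    ∑ D ∈ Finset.range M, avgIncr L D (smooth a (ψ D)) ≤ s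

lemma VariationBound.mono {a L M : ℕ} {s t : ℝ} (h : VariationBound a L M s) (hst : s ≤ t) :
    VariationBound a L M t := fun ψ hψ => (h ψ hψ).trans hst

lemma variationBound_of_forall_smooth_le {a : ℕ} {c : ℝ}
    (h : ∀ ψ : ℤ → ℝ, (∀ x, |ψ x| ≤ 1) → ∀ x, |smooth a ψ x| ≤ c) (L M : ℕ) :
    VariationBound a L M (c * M) := fun ψ hψ => by
  refine (Finset.sum_le_sum fun D _ =>
    (le_abs_self _).trans (abs_avgIncr_le L D (h (ψ D) (hψ D)))).trans ?_
  simp [mul_comm]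

lemma VariationBound.sum_succ {a L M : ℕ} {s : ℝ} (h : VariationBound a L M s) {ψ : ℕ → ℤ → ℝ}
    (hψ : ∀ D x, |ψ D x| ≤ 1) :
    ∑ D ∈ Finset.range M, avgIncr L (D + 1) (smooth a (ψ D)) ≤ s + 4 := by
  have h1 := h (fun D => ψ (D - 1)) fun D x => hψ _ _
  have h2 := Finset.sum_range_succ (fun D => avgIncr L D (smooth a (ψ (D - 1)))) M
  have h3 := Finset.sum_range_succ' (fun D => avgIncr L D (smooth a (ψ (D - 1)))) M
  simp only [Nat.add_sub_cancel] at h3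
  have h4 := abs_le.1 (abs_avgIncr_le L M (abs_smooth_le_two a (hψ (M - 1))))
  have h5 := abs_le.1 (abs_avgIncr_le L 0 (abs_smooth_le_two a (hψ (0 - 1))))
  linarith

/-- Among the four residues modulo `4`, it is `D ≡ 1` that produces an extra factor
`(1 + τ) / 2`, on account of the identity `(2 τ + 1) / 4 = ((1 + τ) / 2) / 2 + τ / 4`. -/
lemma VariationBound.step {a L M : ℕ} {s t : ℝ} (hs : VariationBound (a + 1) L M s)
    (ht : VariationBound a L M t) :
    VariationBound a (L + 2) (4 * M) (s / 2 + 7 / 2 * t + 6) := by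
  intro ψ hψ
  have tr (D : ℕ) (n : ℤ) : smooth a (fun x => ψ D (x + n)) = fun x => smooth a (ψ D) (x + n) :=
    funext fun x => smooth_translate a (ψ D) n x
  have bd (i : ℕ) (n : ℤ) (D : ℕ) (x : ℤ) : |ψ (4 * D + i) (x + n)| ≤ 1 := hψ _ _
  have e0 (D : ℕ) : avgIncr (L + 2) (4 * D) (smooth a (ψ (4 * D)))
      = avgIncr L D (smooth a (ψ (4 * D + 0))) := by
    rw [show 4 * D = 2 * (2 * D) by ring, avgIncr_two_mul, avgIncr_two_mul, add_zero]
  have e1 (D : ℕ) : avgIncr (L + 2) (4 * D + 1) (smooth a (ψ (4 * D + 1)))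
      = 1 / 2 * avgIncr L D (smooth (a + 1) fun x => ψ (4 * D + 1) (x + 0))
        + 1 / 4 * avgIncr L D (smooth a fun x => ψ (4 * D + 1) (x + 1))
        + 1 / 4 * avgIncr L (D + 1) (smooth a fun x => ψ (4 * D + 1) (x + -2)) := by
    conv_lhs => rw [show 4 * D + 1 = 2 * (2 * D) + 1 by ring, avgIncr_two_mul_add_one,
      avgIncr_two_mul, avgIncr_two_mul_add_one, show 2 * (2 * D) + 1 = 4 * D + 1 by ring]
    have : avgIncr L D (smooth (a + 1) fun x => ψ (4 * D + 1) (x + 0))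
        = 1 / 2 * (avgIncr L D (smooth a (ψ (4 * D + 1)))
          + avgIncr L D fun x => smooth a (ψ (4 * D + 1)) (x + 1)) := by
      rw [← avgIncr_add, ← avgIncr_const_mul]
      simp only [smooth, add_zero]
      congr 1
      funext x
      ring
    rw [this, tr, tr]
    simp only [sub_sub, add_sub_cancel_right]
    simp only [sub_eq_add_neg]
    norm_num
    ring
  have e2 (D : ℕ) : avgIncr (L + 2) (4 * D + 2) (smooth a (ψ (4 * D + 2)))
      = 1 / 2 * avgIncr L D (smooth a fun x => ψ (4 * D + 2) (x + 1))
        + 1 / 2 * avgIncr L (D + 1) (smooth a fun x => ψ (4 * D + 2) (x + -1)) := by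
    conv_lhs => rw [show 4 * D + 2 = 2 * (2 * D + 1) by ring, avgIncr_two_mul,
      avgIncr_two_mul_add_one, show 2 * (2 * D + 1) = 4 * D + 2 by ring]
    rw [tr, tr]
    simp only [sub_eq_add_neg]
    ring
  have e3 (D : ℕ) : avgIncr (L + 2) (4 * D + 3) (smooth a (ψ (4 * D + 3)))
      = 1 / 4 * avgIncr L D (smooth a fun x => ψ (4 * D + 3) (x + 2))
        + 1 / 4 * avgIncr L (D + 1) (smooth a fun x => ψ (4 * D + 3) (x + 0))
        + 1 / 2 * avgIncr L (D + 1) (smooth a fun x => ψ (4 * D + 3) (x + -1)) := by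
    conv_lhs => rw [show 4 * D + 3 = 2 * (2 * D + 1) + 1 by ring, avgIncr_two_mul_add_one,
      show 2 * D + 1 + 1 = 2 * (D + 1) by ring, avgIncr_two_mul,
      avgIncr_two_mul_add_one, show 2 * (2 * D + 1) + 1 = 4 * D + 3 by ring]
    rw [tr, tr, tr]
    simp only [sub_add_cancel, add_assoc, add_zero]
    simp only [sub_eq_add_neg]
    norm_num
    ring
  have hsum : ∑ D ∈ Finset.range (4 * M), avgIncr (L + 2) D (smooth a (ψ D))
      = ∑ D ∈ Finset.range M, (avgIncr (L + 2) (4 * D) (smooth a (ψ (4 * D)))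
        + avgIncr (L + 2) (4 * D + 1) (smooth a (ψ (4 * D + 1)))
        + avgIncr (L + 2) (4 * D + 2) (smooth a (ψ (4 * D + 2)))
        + avgIncr (L + 2) (4 * D + 3) (smooth a (ψ (4 * D + 3)))) := by
    rw [show 4 * M = 2 * (2 * M) by ring, sum_range_two_mul, sum_range_two_mul]
    refine Finset.sum_congr rfl fun D _ => ?_
    rw [show 2 * (2 * D) = 4 * D by ring, show 2 * (2 * D + 1) = 4 * D + 2 by ring]
    ring
  rw [hsum]
  simp only [e0, e1, e2, e3]
  simp only [Finset.sum_add_distrib, ← Finset.mul_sum]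
  have a0 := ht (fun D => ψ (4 * D + 0)) fun D x => hψ _ _
  have a1 := hs _ (bd 1 0)
  have a2 := ht _ (bd 1 1)
  have a3 := ht.sum_succ (bd 1 (-2))
  have a4 := ht _ (bd 2 1)
  have a5 := ht.sum_succ (bd 2 (-1))
  have a6 := ht _ (bd 3 2)
  have a7 := ht.sum_succ (bd 3 0)
  have a8 := ht.sum_succ (bd 3 (-1))
  linarith

/-- The variation norms in `VariationBound` have means over `D < 4 ^ p` that are eventually at
most `c`, uniformly in `L`. -/
def EventuallyFlat (a : ℕ) (c : ℝ) : Prop :=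
  ∃ p₀, ∀ p ≥ p₀, ∀ L, VariationBound a (L + 2 * p) (4 ^ p) (c * 4 ^ p)

/-- One factor `(1 + τ) / 2` can be dropped: by `VariationBound.step` the mean for `a` is, at each
new scale, a convex combination with weights `7/8`, `1/8` of the mean for `a` and the mean for
`a + 1`, up to an error that decays geometrically. -/
lemma EventuallyFlat.of_succ {a : ℕ} {c ε : ℝ} (hc : 0 ≤ c) (h : EventuallyFlat (a + 1) c)
    (hε : 0 < ε) : EventuallyFlat a (c + ε) := by
  obtain ⟨p₀, h⟩ := h
  have key : ∀ i L, VariationBound a (L + 2 * (p₀ + i)) (4 ^ (p₀ + i))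
      ((c + 5 * (7 / 8) ^ i - 3 * (1 / 4) ^ i) * 4 ^ (p₀ + i)) := by
    intro i
    induction i with
    | zero =>
      intro L
      have := variationBound_of_forall_smooth_le
        (fun ψ hψ x => abs_smooth_le_two a hψ x) (L + 2 * (p₀ + 0)) (4 ^ (p₀ + 0))
      refine this.mono ?_
      push_cast
      refine mul_le_mul_of_nonneg_right ?_ (by positivity)
      norm_num
      linarith
    | succ i ih =>
      intro L
      have h1 := (h (p₀ + i) (by omega) L).step (ih L)
      rw [show L + 2 * (p₀ + (i + 1)) = L + 2 * (p₀ + i) + 2 by ring,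
        show 4 ^ (p₀ + (i + 1)) = 4 * 4 ^ (p₀ + i) by ring]
      refine h1.mono ?_
      have h2 : (1 : ℝ) ≤ (1 / 4) ^ i * 4 ^ (p₀ + i) := by
        rw [pow_add, mul_left_comm, ← mul_pow]
        norm_num
        exact one_le_pow₀ (by norm_num)
      have e : (4 : ℝ) ^ (p₀ + (i + 1)) = 4 * 4 ^ (p₀ + i) := by ring
      rw [e, pow_succ, pow_succ]
      nlinarith
  have hlim : Tendsto (fun i : ℕ => 5 * (7 / 8 : ℝ) ^ i) atTop (𝓝 0) := by
    simpa using (tendsto_pow_atTop_nhds_zero_of_lt_one (by norm_num : (0 : ℝ) ≤ 7 / 8)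
      (by norm_num)).const_mul 5
  obtain ⟨i₀, hi₀⟩ := eventually_atTop.1 (hlim.eventually (gt_mem_nhds hε))
  refine ⟨p₀ + i₀, fun p hp L => ?_⟩
  obtain ⟨i, rfl⟩ := Nat.exists_eq_add_of_le (show p₀ ≤ p by omega)
  refine (key i L).mono (mul_le_mul_of_nonneg_right ?_ (by positivity))
  have := hi₀ i (by omega)
  have h3 : (0 : ℝ) ≤ 3 * (1 / 4) ^ i := by positivity
  linarith

lemma eventuallyFlat_zero {ε : ℝ} (hε : 0 < ε) : EventuallyFlat 0 ε := by
  obtain ⟨a, ha⟩ := exists_forall_smooth_le (half_pos hε)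
  have h0 : EventuallyFlat a (ε / 2) :=
    ⟨0, fun p _ L => by
      simpa using variationBound_of_forall_smooth_le ha (L + 2 * p) (4 ^ p)⟩
  -- each of the `a` steps down costs at most a share of `ε / 2`
  have key : ∀ i ≤ a, EventuallyFlat (a - i) (ε / 2 + i * (ε / (2 * (a + 1)))) := by
    intro i
    induction i with
    | zero => intro _; simpa using h0
    | succ i ih =>
      intro hi
      have h1 := ih (by omega)
      rw [show a - i = a - (i + 1) + 1 by omega] at h1
      have := h1.of_succ (by positivity) (show 0 < ε / (2 * (a + 1)) by positivity)
      convert this using 1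
      push_cast
      ring
  have h1 := key a le_rfl
  rw [Nat.sub_self] at h1
  obtain ⟨p₀, h⟩ := h1
  refine ⟨p₀, fun p hp L => (h p hp L).mono (mul_le_mul_of_nonneg_right ?_ (by positivity))⟩
  have : (a : ℝ) * (ε / (2 * (a + 1))) ≤ ε / 2 := by
    rw [mul_div_assoc', div_le_div_iff₀ (by positivity) (by positivity)]
    nlinarith
  linarith

/-- For most `D` the law of `s(I + D) - s(I)` is almost invariant under translation by `1`. -/
lemma exists_variationBound {ε : ℝ} (hε : 0 < ε) :
    ∃ M₀, ∀ M ≥ M₀, ∃ L₀, ∀ L ≥ L₀, VariationBound 0 L M (ε * M) := by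
  obtain ⟨p₀, h⟩ := eventuallyFlat_zero (show 0 < ε / 4 by positivity)
  refine ⟨4 ^ p₀ + 1, fun M hM => ?_⟩
  have hM2 : 1 < M := by
    have : 0 < 4 ^ p₀ := by positivity
    omega
  set p := Nat.clog 4 M with hp
  have h1 : M ≤ 4 ^ p := Nat.le_pow_clog (by norm_num) M
  have h2 : 4 ^ (p - 1) < M := Nat.pow_pred_clog_lt_self (by norm_num) hM2
  have h3 : 0 < p := Nat.clog_pos (by norm_num) hM2
  have h4 : p₀ < p := (Nat.pow_lt_pow_iff_right (by norm_num : 1 < 4)).1 (by omega)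
  have h5 : 4 ^ p ≤ 4 * M := by
    obtain ⟨p', hp'⟩ := Nat.exists_eq_succ_of_ne_zero h3.ne'
    rw [hp'] at h2 ⊢
    rw [pow_succ]
    simp only [Nat.succ_sub_one] at h2
    omega
  refine ⟨2 * p, fun L hL => ?_⟩
  obtain ⟨L', rfl⟩ := Nat.exists_eq_add_of_le' hL
  intro ψ hψ
  have h6 := h p h4.le L' (fun D x => if D < M then ψ D x else 0) fun D x => by
    split_ifs
    · exact hψ D x
    · simp
  have h7 : ∑ D ∈ Finset.range (4 ^ p),
      avgIncr (L' + 2 * p) D (smooth 0 fun x => if D < M then ψ D x else 0)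
      = ∑ D ∈ Finset.range M, avgIncr (L' + 2 * p) D (smooth 0 (ψ D)) := by
    rw [← Finset.sum_subset (Finset.range_subset_range.2 h1)]
    · exact Finset.sum_congr rfl fun D hD => by simp [Finset.mem_range.1 hD]
    · intro D _ hD
      rw [Finset.mem_range] at hD
      simp [hD, smooth, avgIncr]
  rw [h7] at h6
  refine h6.trans ?_
  have : (4 : ℝ) ^ p ≤ 4 * M := by exact_mod_cast h5
  nlinarith

/-! ### The frequencies of the distances between blocks -/

/-- The frequency, among the blocks `I < 2 ^ L`, of those for which one of the next `m` blocks
starts at distance `d`. -/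
noncomputable def hitFreq (b : ℕ → ℕ) (k L m : ℕ) (d : ℤ) : ℝ :=
  (∑ I ∈ Finset.range (2 ^ L), ∑ D ∈ Finset.range m,
    if (blockPos b k (I + D) : ℤ) = blockPos b k I + d then (1 : ℝ) else 0) / 2 ^ L

lemma hitFreq_eq_sum_avgIncr (hb : ∀ n : ℕ, 1 ≤ n → ∃ k : ℕ, b n = 2 ^ k) (k L m : ℕ) (d : ℤ) :
    hitFreq b k L m d = ∑ D ∈ Finset.range m,
      avgIncr L D fun x => if 2 * (letterCount b k : ℤ) * D - x = d then 1 else 0 := by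
  simp only [avgIncr, hitFreq]
  rw [Finset.sum_comm, Finset.sum_div]
  refine Finset.sum_congr rfl fun D _ => ?_
  congr 1
  refine Finset.sum_congr rfl fun I _ => ?_
  have h1 : (blockPos b k I : ℤ) + digitSum I = 2 * letterCount b k * I := by
    exact_mod_cast blockPos_add_digitSum hb k I
  have h2 : (blockPos b k (I + D) : ℤ) + digitSum (I + D) = 2 * letterCount b k * (I + D) := by
    exact_mod_cast blockPos_add_digitSum hb k (I + D)
  rw [mul_add] at h2
  refine if_congr ⟨fun h => ?_, fun h => ?_⟩ rfl rfl <;> linarith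

lemma abs_sum_ite_eq_le (n : ℕ) (σ : ℕ → ℝ) (hσ : ∀ d, |σ d| ≤ 1) (z : ℤ) :
    |∑ d ∈ Finset.range n, if z = d then σ d else 0| ≤ 1 := by
  by_cases hz : 0 ≤ z
  · lift z to ℕ using hz
    simp only [Nat.cast_inj]
    rw [Finset.sum_ite_eq]
    split_ifs
    · exact hσ z
    · simp
  · rw [Finset.sum_eq_zero]
    · simp
    · intro d _
      rw [if_neg]
      omega

lemma sum_abs_hitFreq_sub_le (hb : ∀ n : ℕ, 1 ≤ n → ∃ k : ℕ, b n = 2 ^ k) {k L m : ℕ} {s : ℝ}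
    (h : VariationBound 0 L m s) (n : ℕ) :
    ∑ d ∈ Finset.range n, |hitFreq b k L m ((d : ℤ) + 1) - hitFreq b k L m d| ≤ s := by
  set p := hitFreq b k L m
  let σ : ℕ → ℝ := fun d => if 0 ≤ p ((d : ℤ) + 1) - p d then 1 else -1
  have hσ (d : ℕ) : |σ d| ≤ 1 := by simp only [σ]; split_ifs <;> simp
  have hσ' (d : ℕ) : |p ((d : ℤ) + 1) - p d| = σ d * (p ((d : ℤ) + 1) - p d) := by
    simp only [σ]
    split_ifs with h0
    · rw [abs_of_nonneg h0, one_mul]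
    · rw [abs_of_neg (not_le.1 h0), neg_one_mul]
  let ψ : ℕ → ℤ → ℝ := fun D x =>
    -∑ d ∈ Finset.range n, if 2 * (letterCount b k : ℤ) * D - x = d then σ d else 0
  refine le_trans (le_of_eq ?_) (h ψ fun D x => by
    simp only [ψ, abs_neg]; exact abs_sum_ite_eq_le n σ hσ _)
  have e (d : ℕ) : |p ((d : ℤ) + 1) - p d| = ∑ D ∈ Finset.range m, avgIncr L D fun x =>
      (if 2 * (letterCount b k : ℤ) * D - (x + 1) = d then σ d else 0)
        + -1 * if 2 * (letterCount b k : ℤ) * D - x = d then σ d else 0 := by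
    rw [hσ']
    simp only [p, hitFreq_eq_sum_avgIncr hb]
    rw [← Finset.sum_sub_distrib, Finset.mul_sum]
    refine Finset.sum_congr rfl fun D _ => ?_
    rw [avgIncr_add, avgIncr_const_mul, mul_sub, ← avgIncr_const_mul, ← avgIncr_const_mul,
      neg_one_mul, ← sub_eq_add_neg]
    congr 2 <;> funext x
    · rw [mul_ite, mul_one, mul_zero]
      exact if_congr ⟨fun h => by linarith, fun h => by linarith⟩ rfl rfl
    · rw [mul_ite, mul_one, mul_zero]
  rw [Finset.sum_congr rfl fun d _ => e d, Finset.sum_comm]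
  refine Finset.sum_congr rfl fun D _ => ?_
  simp only [avgIncr, ψ, smooth]
  rw [← Finset.sum_div, Finset.sum_comm]
  congr 1
  refine Finset.sum_congr rfl fun I _ => ?_
  rw [Finset.sum_add_distrib, ← Finset.mul_sum]
  ring

lemma wordLength_pos (hb : ∀ n : ℕ, 1 ≤ n → ∃ k : ℕ, b n = 2 ^ k) (k : ℕ) :
    0 < wordLength b k := by
  have h1 := wordLength_add_one hb k
  have h2 := letterCount_pos hb k
  omega

lemma blockPos_add_le (hb : ∀ n : ℕ, 1 ≤ n → ∃ k : ℕ, b n = 2 ^ k) (k I D : ℕ) :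
    blockPos b k I + wordLength b k * D ≤ blockPos b k (I + D) := by
  induction D with
  | zero => simp
  | succ D ih =>
    have := blockPos_succ hb k (I + D)
    rw [← add_assoc, mul_add]
    omega

/-- A window of length `R` contains the beginnings of at most `R / a_k + 1` blocks. -/
lemma card_window_le {F : ℕ → ℤ} {h : ℕ} (hh : 0 < h)
    (hF : ∀ D D', F D + h * D' ≤ F (D + D')) (m R : ℕ) (c : ℤ) :
    (((Finset.range m).filter fun D => c ≤ F D ∧ F D < c + R).card : ℝ) ≤ R / h + 1 := by
  set T := (Finset.range m).filter fun D => c ≤ F D ∧ F D < c + R with hT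
  rcases T.eq_empty_or_nonempty with h0 | h0
  · rw [h0]; simp; positivity
  · have h1 := T.min'_mem h0
    have h2 := T.max'_mem h0
    have h3 : T ⊆ Finset.Icc (T.min' h0) (T.max' h0) := fun D hD =>
      Finset.mem_Icc.2 ⟨T.min'_le D hD, T.le_max' D hD⟩
    have h4 := Finset.card_le_card h3
    rw [Nat.card_Icc] at h4
    have h5 := T.min'_le _ h2
    obtain ⟨e, he⟩ := Nat.exists_eq_add_of_le h5
    have h6 := hF (T.min' h0) e
    rw [← he] at h6
    simp only [hT, Finset.mem_filter] at h1 h2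
    have h7 : (h : ℤ) * e ≤ R := by linarith [h1.2.1, h2.2.2]
    have h8 : (h : ℝ) * e ≤ R := by exact_mod_cast h7
    have h9 : T.card ≤ e + 1 := by omega
    have h10 : (T.card : ℝ) ≤ e + 1 := by exact_mod_cast h9
    have h11 : (e : ℝ) ≤ R / h := by
      rw [le_div_iff₀ (by exact_mod_cast hh)]; linarith
    linarith

lemma sum_window_ite (R : ℕ) (z d : ℤ) :
    ∑ i ∈ Finset.range R, (if z = d + i then (1 : ℝ) else 0)
      = if d ≤ z ∧ z < d + R then 1 else 0 := by
  by_cases hz : d ≤ z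
  · obtain ⟨j, hj⟩ := Int.eq_ofNat_of_zero_le (sub_nonneg.2 hz)
    have : z = d + j := by linarith
    subst this
    have h (i : ℕ) : (d + (j : ℤ) = d + i) ↔ j = i := by omega
    simp only [h, Finset.sum_ite_eq, Finset.mem_range]
    refine if_congr ?_ rfl rfl
    omega
  · rw [if_neg (by tauto)]
    refine Finset.sum_eq_zero fun i _ => if_neg ?_
    omega

lemma sum_window_hitFreq_le (hb : ∀ n : ℕ, 1 ≤ n → ∃ k : ℕ, b n = 2 ^ k) (k L m R : ℕ) (d : ℤ) :
    ∑ i ∈ Finset.range R, hitFreq b k L m (d + i) ≤ R / wordLength b k + 1 := by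
  simp only [hitFreq]
  rw [← Finset.sum_div, div_le_iff₀ (by positivity), Finset.sum_comm]
  have h (I : ℕ) : ∑ i ∈ Finset.range R, ∑ D ∈ Finset.range m,
      (if (blockPos b k (I + D) : ℤ) = blockPos b k I + (d + i) then (1 : ℝ) else 0)
      ≤ R / wordLength b k + 1 := by
    rw [Finset.sum_comm]
    simp only [← add_assoc, sum_window_ite]
    rw [Finset.sum_boole]
    refine card_window_le (F := fun D => (blockPos b k (I + D) : ℤ)) (wordLength_pos hb k) ?_ m R _
    intro D D'
    have := blockPos_add_le hb k (I + D) D'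
    rw [← add_assoc]
    exact_mod_cast this
  refine (Finset.sum_le_sum fun I _ => h I).trans ?_
  rw [Finset.sum_const, Finset.card_range, nsmul_eq_mul, mul_comm]
  push_cast
  exact le_rfl

/-- The frequency of the distance `d` is, for most `d`, not much larger than `1 / a_k`: it varies
slowly in `d`, and its means over windows are at most that large. -/
lemma exists_sum_hitFreq_excess_le (hb : ∀ n : ℕ, 1 ≤ n → ∃ k : ℕ, b n = 2 ^ k) (k : ℕ) {ε : ℝ}
    (hε : 0 < ε) : ∃ n₀, ∀ n ≥ n₀, ∃ L₀, ∀ L ≥ L₀,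
      ∑ d ∈ Finset.range n, max 0 (hitFreq b k L n d - 1 / wordLength b k) ≤ ε * n := by
  obtain ⟨R, hR⟩ := exists_nat_gt (2 / ε)
  have hR0 : (0 : ℝ) < R := lt_trans (by positivity) hR
  obtain ⟨M₀, hM⟩ := exists_variationBound (show 0 < ε / (2 * R) by positivity)
  refine ⟨M₀, fun n hn => ?_⟩
  obtain ⟨L₀, hL⟩ := hM n hn
  refine ⟨L₀, fun L hL' => ?_⟩
  have hV := hL L hL'
  set p := hitFreq b k L n with hp
  set v : ℕ → ℝ := fun d => |p ((d : ℤ) + 1) - p d| with hv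
  have hv0 (d : ℕ) : 0 ≤ v d := abs_nonneg _
  have h1 (d i : ℕ) : p d ≤ p ((d : ℤ) + i) + ∑ l ∈ Finset.range i, v (d + l) := by
    induction i with
    | zero => simp
    | succ i ih =>
      rw [Finset.sum_range_succ]
      have h2 : p ((d + i : ℕ) : ℤ) - p (((d + i : ℕ) : ℤ) + 1) ≤ v (d + i) := by
        simp only [hv]; rw [abs_sub_comm]; exact le_abs_self _
      push_cast at h2 ⊢
      rw [← add_assoc (d : ℤ)]
      linarith
  have h2 (d : ℕ) : max 0 (p d - 1 / wordLength b k)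
      ≤ 1 / R + ∑ l ∈ Finset.range R, v (d + l) := by
    have hs : 0 ≤ ∑ l ∈ Finset.range R, v (d + l) := Finset.sum_nonneg fun _ _ => hv0 _
    refine max_le (by positivity) ?_
    have h3 : ∑ i ∈ Finset.range R, p d
        ≤ ∑ i ∈ Finset.range R, (p ((d : ℤ) + i) + ∑ l ∈ Finset.range R, v (d + l)) := by
      refine Finset.sum_le_sum fun i hi => (h1 d i).trans ?_
      have := Finset.sum_le_sum_of_subset_of_nonneg (f := fun l => v (d + l))
        (Finset.range_subset_range.2 (Finset.mem_range.1 hi).le) fun _ _ _ => hv0 _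
      linarith
    rw [Finset.sum_add_distrib] at h3
    simp only [Finset.sum_const, Finset.card_range, nsmul_eq_mul] at h3
    have h4 := sum_window_hitFreq_le hb k L n R d
    rw [← hp] at h4
    have h5 : (R : ℝ) * p d
        ≤ R * (1 / wordLength b k + 1 / R + ∑ l ∈ Finset.range R, v (d + l)) := by
      have e : (R : ℝ) * (1 / wordLength b k + 1 / R + ∑ l ∈ Finset.range R, v (d + l))
          = R / wordLength b k + 1 + R * ∑ l ∈ Finset.range R, v (d + l) := by
        field_simp
      rw [e]; linarith
    have h6 := le_of_mul_le_mul_left h5 hR0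
    linarith
  refine (Finset.sum_le_sum fun d _ => h2 d).trans ?_
  rw [Finset.sum_add_distrib, Finset.sum_comm]
  have h3 (l : ℕ) : ∑ d ∈ Finset.range n, v (d + l) ≤ ε / (2 * R) * n := by
    have h4 := sum_abs_hitFreq_sub_le hb (k := k) hV (n + l)
    refine le_trans ?_ h4
    rw [add_comm n l, Finset.sum_range_add]
    have : ∑ d ∈ Finset.range n, v (d + l) = ∑ d ∈ Finset.range n, v (l + d) :=
      Finset.sum_congr rfl fun d _ => by rw [add_comm]
    rw [this]
    exact le_add_of_nonneg_left (Finset.sum_nonneg fun d _ => hv0 d)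
  have h4 : ∑ l ∈ Finset.range R, ∑ d ∈ Finset.range n, v (d + l)
      ≤ ∑ l ∈ Finset.range R, ε / (2 * R) * n := Finset.sum_le_sum fun l _ => h3 l
  simp only [Finset.sum_const, Finset.card_range, nsmul_eq_mul] at h4 ⊢
  have h5 : (R : ℝ) * (ε / (2 * R) * n) = ε / 2 * n := by field_simp
  have h6 : (1 : ℝ) / R ≤ ε / 2 := by
    rw [div_le_div_iff₀ hR0 (by norm_num)]
    have := (div_lt_iff₀ hε).1 hR
    linarith
  have h7 := mul_le_mul_of_nonneg_left h6 (Nat.cast_nonneg (α := ℝ) n)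
  linarith

/-! ### Blocks with a common slot are rare -/

lemma exists_card_slot_eq_le (hb : ∀ n : ℕ, 1 ≤ n → ∃ k : ℕ, b n = 2 ^ k) (r k : ℕ) :
    ∃ C : ℝ, ∀ v x n : ℕ, (((Finset.Ico x (x + n)).filter fun J => slot b k J = v).card : ℝ)
      ≤ n / ((∏ i ∈ Finset.range r, b (k + i + 1) : ℕ) : ℝ) + C := by
  induction r generalizing k with
  | zero =>
    refine ⟨0, fun v x n => ?_⟩
    have := Finset.card_filter_le (Finset.Ico x (x + n)) fun J => slot b k J = v
    rw [Nat.card_Ico, Nat.add_sub_cancel_left] at this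
    simpa using this
  | succ r ih =>
    obtain ⟨C, hC⟩ := ih (k + 1)
    refine ⟨4 + 2 * C, fun v x n => ?_⟩
    set β := b (k + 1) with hβ
    have hβ0 : 0 < β := pos_of_isPow hb k
    set P : ℕ := ∏ i ∈ Finset.range r, b (k + 1 + i + 1) with hP
    have hP1 : 1 ≤ P := Finset.prod_pos fun i _ => pos_of_isPow hb _
    have hprod : ∏ i ∈ Finset.range (r + 1), b (k + i + 1) = β * P := by
      rw [Finset.prod_range_succ', mul_comm]
      congr 1
      exact Finset.prod_congr rfl fun i _ => by congr 1; ring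
    set T := (Finset.Ico x (x + n)).filter fun J => slot b k J = v with hT
    have hmod (J : ℕ) (hJ : slot b k J = v) :
        slot b (k + 1) (J / (2 * β)) = v / β ∧ J % (2 * β) % β = v % β := by
      have h1 := slot_mul_add b k (J / (2 * β)) (J % (2 * β)) (Nat.mod_lt _ (by omega))
      rw [← hβ, mul_comm (J / _), Nat.div_add_mod, hJ] at h1
      rw [h1, Nat.add_mul_div_left _ _ hβ0, Nat.div_eq_of_lt (Nat.mod_lt _ hβ0),
        Nat.add_mul_mod_self_left, Nat.mod_mod]
      simp
    -- a word of `𝒜_{k+1}` contains every word of its own free choice just twice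
    have hfib : ∀ Q ∈ T.image fun J => J / (2 * β),
        (T.filter fun J => J / (2 * β) = Q).card ≤ 2 := by
      intro Q _
      have : (T.filter fun J => J / (2 * β) = Q)
          ⊆ {2 * β * Q + v % β, 2 * β * Q + (v % β + β)} := by
        intro J hJ
        simp only [hT, Finset.mem_filter] at hJ
        have h1 := (hmod J hJ.1.2).2
        have h2 : 2 * β * Q + J % (2 * β) = J := by rw [← hJ.2]; exact Nat.div_add_mod _ _
        have h3 : J % (2 * β) < 2 * β := Nat.mod_lt _ (by omega)
        have h4 : J % (2 * β) = v % β ∨ J % (2 * β) = v % β + β := by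
          rcases lt_or_ge (J % (2 * β)) β with h | h
          · exact Or.inl ((Nat.mod_eq_of_lt h).symm.trans h1)
          · have e := Nat.mod_eq_sub_mod h
            rw [Nat.mod_eq_of_lt (show J % (2 * β) - β < β by omega)] at e
            omega
        simp only [Finset.mem_insert, Finset.mem_singleton]
        rcases h4 with h4 | h4 <;> rw [h4] at h2
        · left; exact h2.symm
        · right; exact h2.symm
      exact (Finset.card_le_card this).trans Finset.card_le_two
    have h1 := Finset.card_le_mul_card_image T 2 hfib
    have h2 : T.image (fun J => J / (2 * β)) ⊆
        (Finset.Ico (x / (2 * β)) (x / (2 * β) + (n / (2 * β) + 2))).filter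
          fun J => slot b (k + 1) J = v / β := by
      intro Q hQ
      simp only [hT, Finset.mem_image, Finset.mem_filter, Finset.mem_Ico] at hQ ⊢
      obtain ⟨J, ⟨⟨h3, h4⟩, h5⟩, rfl⟩ := hQ
      refine ⟨⟨Nat.div_le_div_right h3, ?_⟩, (hmod J h5).1⟩
      rw [Nat.div_lt_iff_lt_mul (by omega)]
      have e1 := Nat.div_add_mod x (2 * β)
      have e2 := Nat.div_add_mod n (2 * β)
      have e3 := Nat.mod_lt x (show 0 < 2 * β by omega)
      have e4 := Nat.mod_lt n (show 0 < 2 * β by omega)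
      have e5 : (x / (2 * β) + (n / (2 * β) + 2)) * (2 * β)
        = 2 * β * (x / (2 * β)) + 2 * β * (n / (2 * β)) + 2 * (2 * β) := by ring
      omega
    have h3 := hC (v / β) (x / (2 * β)) (n / (2 * β) + 2)
    have h4 : (T.card : ℝ) ≤ 2 * (((n / (2 * β) + 2 : ℕ) : ℝ) / P + C) := by
      refine le_trans ?_ (mul_le_mul_of_nonneg_left h3 (by norm_num))
      exact_mod_cast h1.trans (Nat.mul_le_mul_left 2 (Finset.card_le_card h2))
    refine h4.trans ?_
    rw [hprod]
    have hP0 : (1 : ℝ) ≤ P := by exact_mod_cast hP1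
    have hβ1 : (0 : ℝ) < β := by exact_mod_cast hβ0
    have h5 : ((n / (2 * β) + 2 : ℕ) : ℝ) ≤ n / (2 * β) + 2 := by
      push_cast
      have := @Nat.cast_div_le ℝ _ _ _ n (2 * β)
      push_cast at this
      linarith
    have h6 : ((n / (2 * β) + 2 : ℕ) : ℝ) / P ≤ (n / (2 * β) + 2) / P := by gcongr
    have h7 : ((n : ℝ) / (2 * β) + 2) / P = n / (β * P) / 2 + 2 / P := by field_simp
    have h8 : (2 : ℝ) / P ≤ 2 := div_le_self (by norm_num) hP0
    rw [Nat.cast_mul]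
    linarith

lemma exists_le_prod (hb : ∀ n : ℕ, 1 ≤ n → ∃ k : ℕ, b n = 2 ^ k)
    (hlim : Tendsto (fun n : ℕ => (b (n + 1) : ℝ) / ∏ i ∈ Finset.Icc 1 n, (b i : ℝ)) atTop atTop)
    (k : ℕ) (K : ℝ) : ∃ r, K ≤ ((∏ i ∈ Finset.range r, b (k + i + 1) : ℕ) : ℝ) := by
  obtain ⟨n₀, hn₀⟩ := eventually_atTop.1 (hlim.eventually_ge_atTop 2)
  have h2 (n : ℕ) (hn : n₀ ≤ n) : 2 ≤ b (n + 1) := by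
    have h := hn₀ n hn
    have h1 : (1 : ℝ) ≤ ∏ i ∈ Finset.Icc 1 n, (b i : ℝ) := by
      rw [← Nat.cast_prod]
      refine Nat.one_le_cast.2 (Nat.succ_le_of_lt (Finset.prod_pos fun i hi => ?_))
      obtain ⟨e, he⟩ := hb i (Finset.mem_Icc.1 hi).1
      rw [he]; positivity
    have := h.trans (div_le_self (Nat.cast_nonneg _) h1)
    exact_mod_cast this
  have h3 (j : ℕ) : 2 ^ j ≤ ∏ i ∈ Finset.range (n₀ + j), b (k + i + 1) := by
    induction j with
    | zero => exact Finset.prod_pos fun i _ => pos_of_isPow hb _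
    | succ j ih =>
      rw [← add_assoc, Finset.prod_range_succ, pow_succ]
      exact Nat.mul_le_mul ih (h2 _ (by omega))
  obtain ⟨j, hj⟩ := pow_unbounded_of_one_lt K (one_lt_two : (1 : ℝ) < 2)
  refine ⟨n₀ + j, hj.le.trans ?_⟩
  exact_mod_cast h3 j

/-! ### Convergence of the Cesàro averages -/

/-- `f` is a function of the first `q` coordinates with values in `[0, 1]`. -/
structure IsUnitLocal (q : ℕ) (f : Seq → ℝ) : Prop where
  isLocal : IsLocal q f
  nonneg : ∀ x, 0 ≤ f x
  le_one : ∀ x, f x ≤ 1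

namespace IsUnitLocal

variable {q : ℕ} {f g : Seq → ℝ}

lemma one_sub (hf : IsUnitLocal q f) : IsUnitLocal q fun x => 1 - f x :=
  ⟨hf.isLocal.one_sub, fun x => sub_nonneg.2 (hf.le_one x), fun x => by
    have := hf.nonneg x; linarith⟩

lemma mul_comp_shift (hf : IsUnitLocal q f) (hg : IsUnitLocal q g) (j : ℕ) :
    IsUnitLocal (j + q) fun x => f x * g (shift^[j] x) :=
  ⟨(hf.isLocal.mono (Nat.le_add_left _ _)).mul (hg.isLocal.comp_shift j),
    fun x => mul_nonneg (hf.nonneg x) (hg.nonneg _),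
    fun x => mul_le_one₀ (hf.le_one x) (hg.nonneg _) (hg.le_one _)⟩

lemma comp_shift (hf : IsUnitLocal q f) (j : ℕ) :
    IsUnitLocal (j + q) fun x => f (shift^[j] x) :=
  ⟨hf.isLocal.comp_shift j, fun _ => hf.nonneg _, fun _ => hf.le_one _⟩

lemma abs_le_one (hf : IsUnitLocal q f) (x : Seq) : ‖f x‖ ≤ 1 := by
  rw [Real.norm_eq_abs, abs_of_nonneg (hf.nonneg x)]; exact hf.le_one x

lemma integrable (hf : IsUnitLocal q f) (μ : Measure Seq) [IsFiniteMeasure μ] : Integrable f μ :=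
  .of_bound hf.isLocal.measurable.aestronglyMeasurable 1 (ae_of_all _ hf.abs_le_one)

lemma integrable_shift (hf : IsUnitLocal q f) (b : ℕ → ℕ) (t : ℕ) :
    Integrable (fun ξ => f (shift^[t] (point b ξ))) coin :=
  .of_bound (hf.isLocal.measurable.comp (measurable_shift_point b t)).aestronglyMeasurable 1
    (ae_of_all _ fun _ => hf.abs_le_one _)

lemma meanAt_nonneg (hf : IsUnitLocal q f) (b : ℕ → ℕ) (t : ℕ) : 0 ≤ meanAt b f t :=
  integral_nonneg fun _ => hf.nonneg _

lemma meanAt_le_one (hf : IsUnitLocal q f) (b : ℕ → ℕ) (t : ℕ) : meanAt b f t ≤ 1 := by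
  have := integral_mono (hf.integrable_shift b t) (integrable_const 1) fun _ => hf.le_one _
  simpa [meanAt] using this

lemma meanAt_one_sub (hf : IsUnitLocal q f) (b : ℕ → ℕ) (t : ℕ) :
    meanAt b (fun x => 1 - f x) t = 1 - meanAt b f t := by
  unfold meanAt
  rw [integral_sub (integrable_const 1) (hf.integrable_shift b t)]
  simp

lemma integral_one_sub (hf : IsUnitLocal q f) (μ : Measure Seq) [IsProbabilityMeasure μ] :
    ∫ x, (1 - f x) ∂μ = 1 - ∫ x, f x ∂μ := by
  rw [integral_sub (integrable_const 1) (hf.integrable μ)]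
  simp

end IsUnitLocal

/-- The mean of `f` over the first `n` positions of the random sequence. -/
noncomputable def cesaroMean (b : ℕ → ℕ) (f : Seq → ℝ) (n : ℕ) : ℝ :=
  (∑ t ∈ Finset.range n, meanAt b f t) / n

lemma integral_cesaro {q : ℕ} {f : Seq → ℝ} (hf : IsUnitLocal q f) (n : ℕ) :
    ∫ x, f x ∂(cesaro (process b) n : Measure Seq) = cesaroMean b f n := by
  have h (t : ℕ) : ∫ x, f x ∂((process b).toFiniteMeasure.map (shift^[t]) : Measure Seq)
      = meanAt b f t := by
    rw [FiniteMeasure.toMeasure_map, integral_map (measurable_shift.iterate t).aemeasurable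
      hf.isLocal.measurable.aestronglyMeasurable]
    change ∫ x, f (shift^[t] x) ∂(coin.map (point b)) = _
    rw [integral_map (measurable_point b).aemeasurable]
    · rfl
    · exact (hf.isLocal.measurable.comp (measurable_shift.iterate t)).aestronglyMeasurable
  rw [cesaro, FiniteMeasure.toMeasure_smul, FiniteMeasure.toMeasure_sum,
    integral_smul_nnreal_measure, integral_finsetSum_measure fun t _ => hf.integrable _,
    Finset.sum_congr rfl fun t _ => h t, cesaroMean, div_eq_inv_mul]
  simp [NNReal.smul_def]

lemma sum_range_blockPos (hb : ∀ n : ℕ, 1 ≤ n → ∃ k : ℕ, b n = 2 ^ k) (k M : ℕ) (F : ℕ → ℝ) :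
    ∑ t ∈ Finset.range (blockPos b k M), F t = ∑ I ∈ Finset.range M,
      ∑ r ∈ Finset.range (wordLength b k + omega (I + 1)), F (blockPos b k I + r) := by
  induction M with
  | zero => simp [blockPos_zero]
  | succ M ih => rw [blockPos_succ hb, add_assoc, Finset.sum_range_add, ih, Finset.sum_range_succ]

lemma sum_blocks_le (hb : ∀ n : ℕ, 1 ≤ n → ∃ k : ℕ, b n = 2 ^ k) (k M : ℕ) {F : ℕ → ℝ}
    (hF : ∀ t, 0 ≤ F t) {l : ℕ} (hl : l ≤ wordLength b k) :
    ∑ I ∈ Finset.range M, ∑ r ∈ Finset.range l, F (blockPos b k I + r)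
      ≤ ∑ t ∈ Finset.range (blockPos b k M), F t := by
  rw [sum_range_blockPos hb]
  exact Finset.sum_le_sum fun I _ => Finset.sum_le_sum_of_subset_of_nonneg
    (Finset.range_subset_range.2 (by omega)) fun _ _ _ => hF _

lemma blockPos_le (hb : ∀ n : ℕ, 1 ≤ n → ∃ k : ℕ, b n = 2 ^ k) (k M : ℕ) :
    blockPos b k M ≤ 2 * letterCount b k * M := by
  have := blockPos_add_digitSum hb k M
  omega

lemma div_mul_sum_meanAt_le (hb : ∀ n : ℕ, 1 ≤ n → ∃ k : ℕ, b n = 2 ^ k) {q : ℕ} {f : Seq → ℝ}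
    (hf : IsUnitLocal q f) {k l : ℕ} (hl : l + q ≤ wordLength b k) (n : ℕ) :
    ((n / (2 * letterCount b k) : ℕ) : ℝ) * ∑ r ∈ Finset.range l, meanAt b f r
      ≤ ∑ t ∈ Finset.range n, meanAt b f t := by
  set M := n / (2 * letterCount b k)
  have h1 := sum_blocks_le hb k M (hf.meanAt_nonneg b) (l := l) (by omega)
  have h2 : ∑ I ∈ Finset.range M, ∑ r ∈ Finset.range l, meanAt b f (blockPos b k I + r)
      = M * ∑ r ∈ Finset.range l, meanAt b f r := by
    rw [Finset.sum_congr rfl fun I _ => Finset.sum_congr rfl fun r hr =>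
      meanAt_blockPos_add hb hf.isLocal (show r + q ≤ wordLength b k by
        have := Finset.mem_range.1 hr; omega) I]
    simp
  rw [← h2]
  refine h1.trans (Finset.sum_le_sum_of_subset_of_nonneg (Finset.range_subset_range.2 ?_)
    fun t _ _ => hf.meanAt_nonneg b t)
  exact (blockPos_le hb k M).trans (Nat.mul_div_le _ _)

/-- The blocks of any one level give an asymptotic lower bound for the Cesàro means. -/
lemma eventually_le_cesaroMean (hb : ∀ n : ℕ, 1 ≤ n → ∃ k : ℕ, b n = 2 ^ k) {q : ℕ} {f : Seq → ℝ}
    (hf : IsUnitLocal q f) {k l : ℕ} (hl : l + q ≤ wordLength b k) {ε : ℝ} (hε : 0 < ε) :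
    ∀ᶠ n in atTop, (∑ r ∈ Finset.range l, meanAt b f r) / (2 * letterCount b k) - ε
      ≤ cesaroMean b f n := by
  set F := ∑ r ∈ Finset.range l, meanAt b f r with hF
  have hF0 : 0 ≤ F := Finset.sum_nonneg fun r _ => hf.meanAt_nonneg b r
  have hE : (0 : ℝ) < 2 * letterCount b k := by
    have : (0 : ℝ) < letterCount b k := by exact_mod_cast letterCount_pos hb k
    positivity
  obtain ⟨N, hN⟩ := exists_nat_gt (F / ε)
  filter_upwards [eventually_ge_atTop (N + 1)] with n hn
  have hn0 : (0 : ℝ) < n := by exact_mod_cast (by omega : 0 < n)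
  rw [cesaroMean, le_div_iff₀ hn0]
  refine le_trans ?_ (div_mul_sum_meanAt_le hb hf hl n)
  rw [← hF]
  have h1 : (n : ℝ) / (2 * letterCount b k) - 1 ≤ ((n / (2 * letterCount b k) : ℕ) : ℝ) := by
    have h2 := Nat.lt_floor_add_one ((n : ℝ) / ((2 * letterCount b k : ℕ) : ℝ))
    rw [Nat.floor_div_eq_div] at h2
    push_cast at h2 ⊢
    linarith
  have h2 := mul_le_mul_of_nonneg_right h1 hF0
  have h3 : F ≤ ε * n := by
    have h4 : F / ε ≤ n := hN.le.trans (by exact_mod_cast (by omega : N ≤ n))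
    rwa [div_le_iff₀ hε, mul_comm] at h4
  have e : (F / (2 * letterCount b k) - ε) * n = n / (2 * letterCount b k) * F - ε * n := by ring
  rw [e]
  linarith

lemma exists_tendsto_cesaroMean (hb : ∀ n : ℕ, 1 ≤ n → ∃ k : ℕ, b n = 2 ^ k) {q : ℕ} {f : Seq → ℝ}
    (hf : IsUnitLocal q f) : ∃ c, Tendsto (cesaroMean b f) atTop (𝓝 c) := by
  refine cauchySeq_tendsto_of_complete (Metric.cauchySeq_iff'.2 fun ε hε => ?_)
  -- a level so high that the positions close to the end of a block have frequency below `ε / 4`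
  obtain ⟨k₀, hk₀⟩ := exists_nat_gt ((q + 1) / (ε / 4))
  set k := k₀ + q
  have hk : k ≤ wordLength b k := (wordLength_strictMono hb).le_apply
  obtain ⟨l, hl⟩ := Nat.exists_eq_add_of_le' (show q ≤ wordLength b k by omega)
  set F := (∑ r ∈ Finset.range l, meanAt b f r) / (2 * letterCount b k) with hF
  have hE : (2 * letterCount b k : ℝ) = l + q + 1 := by
    have := wordLength_add_one hb k
    rw [hl] at this
    exact_mod_cast this.symm
  have hE0 : (0 : ℝ) < l + q + 1 := by positivity
  have hsmall : (q + 1 : ℝ) / (2 * letterCount b k) ≤ ε / 4 := by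
    rw [hE, div_le_iff₀ hE0, ← div_le_iff₀' (by positivity)]
    have h1 : (k₀ : ℝ) ≤ l + q := by exact_mod_cast (by omega : k₀ ≤ l + q)
    linarith
  have h1 := eventually_le_cesaroMean hb hf hl.symm.le (show 0 < ε / 8 by positivity)
  have h2 := eventually_le_cesaroMean hb hf.one_sub hl.symm.le (show 0 < ε / 8 by positivity)
  obtain ⟨N, hN⟩ := eventually_atTop.1 (h1.and h2)
  have key : ∀ n ≥ N + 1, F - ε / 8 ≤ cesaroMean b f n ∧ cesaroMean b f n ≤ F + 3 * ε / 8 := by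
    intro n hn
    obtain ⟨h3, h4⟩ := hN n (by omega)
    refine ⟨h3, ?_⟩
    have hn0 : (n : ℝ) ≠ 0 := by exact_mod_cast (by omega : n ≠ 0)
    have h5 : cesaroMean b (fun x => 1 - f x) n = 1 - cesaroMean b f n := by
      simp only [cesaroMean, hf.meanAt_one_sub, Finset.sum_sub_distrib]
      simp [sub_div, hn0]
    simp only [hf.meanAt_one_sub, Finset.sum_sub_distrib] at h4
    simp only [Finset.sum_const, Finset.card_range, nsmul_eq_mul, mul_one, sub_div] at h4
    rw [h5, ← hF] at h4
    have h6 : (l : ℝ) / (2 * letterCount b k) = 1 - (q + 1) / (2 * letterCount b k) := by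
      rw [hE]; field_simp; ring
    rw [h6] at h4
    linarith
  refine ⟨N + 1, fun n hn => ?_⟩
  have h3 := key n hn
  have h4 := key (N + 1) le_rfl
  rw [Real.dist_eq, abs_lt]
  constructor <;> linarith

lemma isUnitLocal_indicator {q : ℕ} {s : Set Seq}
    (hs : ∀ x y : Seq, (∀ i < q, x i = y i) → (x ∈ s ↔ y ∈ s)) :
    IsUnitLocal q (s.indicator fun _ => (1 : ℝ)) := by
  refine ⟨fun x y h => ?_, fun x => Set.indicator_nonneg (fun _ _ => zero_le_one) x,
    fun x => Set.indicator_le_self' (fun _ _ => zero_le_one) x⟩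
  have := hs x y h
  by_cases hx : x ∈ s
  · rw [Set.indicator_of_mem hx, Set.indicator_of_mem (this.1 hx)]
  · rw [Set.indicator_of_notMem hx, Set.indicator_of_notMem (fun h => hx (this.2 h))]

lemma cylinder_isUnitLocal (u : List Letter) :
    IsUnitLocal u.length ((cylinder u).indicator fun _ => (1 : ℝ)) :=
  isUnitLocal_indicator fun x y h => forall₂_congr fun i hi => by rw [h i hi]

lemma measure_eq_of_integral_eq {μ ν : Measure Seq} [IsProbabilityMeasure μ]
    [IsProbabilityMeasure ν]
    (h : ∀ q f, IsUnitLocal q f → ∫ x, f x ∂μ = ∫ x, f x ∂ν) : μ = ν := by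
  refine measure_ext_of_cylinder (a := id) (fun q => ⟨q, le_rfl⟩) fun k u _ => ?_
  have := h _ _ (cylinder_isUnitLocal u)
  rw [integral_indicator_const _ (measurableSet_cylinder u),
    integral_indicator_const _ (measurableSet_cylinder u)] at this
  simpa [measureReal_def, ENNReal.toReal_eq_toReal_iff'] using this

lemma cesaro_mass (n : ℕ) : IsProbabilityMeasure (cesaro (process b) (n + 1) : Measure Seq) := by
  refine ⟨?_⟩
  have h := integral_cesaro (b := b) (q := 0) (f := fun _ => 1)
    ⟨fun _ _ _ => rfl, fun _ => zero_le_one, fun _ => le_rfl⟩ (n + 1)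
  have h2 : cesaroMean b (fun _ => 1) (n + 1) = 1 := by
    simp only [cesaroMean, meanAt, integral_const, probReal_univ, smul_eq_mul, mul_one,
      Finset.sum_const, Finset.card_range, nsmul_eq_mul]
    exact div_self (by positivity)
  rw [h2] at h
  simp only [integral_const, smul_eq_mul, mul_one, measureReal_def] at h
  rwa [ENNReal.toReal_eq_one_iff] at h

/-- The Cesàro averages of the process converge weakly: the space of probability measures is
compact, and all cluster points integrate functions of finitely many coordinates alike. -/
lemma exists_tendsto_cesaro (hb : ∀ n : ℕ, 1 ≤ n → ∃ k : ℕ, b n = 2 ^ k) :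
    ∃ μ : ProbabilityMeasure Seq,
      Tendsto (cesaro (process b)) atTop (𝓝 μ.toFiniteMeasure) ∧
      ∀ q f, IsUnitLocal q f →
        Tendsto (cesaroMean b f) atTop (𝓝 (∫ x, f x ∂(μ : Measure Seq))) := by
  let P : ℕ → ProbabilityMeasure Seq := fun n => ⟨cesaro (process b) (n + 1), cesaro_mass n⟩
  have hP (U : Ultrafilter ℕ) (hU : (U : Filter ℕ) ≤ atTop) (μ : ProbabilityMeasure Seq)
      (hμ : Tendsto P U (𝓝 μ)) (q : ℕ) (f : Seq → ℝ) (hf : IsUnitLocal q f) :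
      Tendsto (cesaroMean b f) atTop (𝓝 (∫ x, f x ∂(μ : Measure Seq))) := by
    obtain ⟨c, hc⟩ := exists_tendsto_cesaroMean hb hf
    have h1 := ProbabilityMeasure.tendsto_iff_forall_integral_tendsto.1 hμ
      (BoundedContinuousFunction.ofNormedAddCommGroup f hf.isLocal.continuous 1 hf.abs_le_one)
    have h2 : Tendsto (fun n => cesaroMean b f (n + 1)) U (𝓝 (∫ x, f x ∂(μ : Measure Seq))) := by
      refine h1.congr fun n => ?_
      exact integral_cesaro hf (n + 1)
    have h3 := (hc.comp (tendsto_add_atTop_nat 1)).mono_left hU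
    rwa [tendsto_nhds_unique h2 h3]
  have hex (U : Ultrafilter ℕ) : ∃ μ, Tendsto P U (𝓝 μ) := by
    obtain ⟨μ, -, hμ⟩ := isCompact_univ.ultrafilter_le_nhds (U.map P) (by simp)
    exact ⟨μ, hμ⟩
  obtain ⟨μ, hμ⟩ := hex (Ultrafilter.of atTop)
  have hμ' := hP _ (Ultrafilter.of_le atTop) μ hμ
  refine ⟨μ, ?_, hμ'⟩
  have hlim : Tendsto P atTop (𝓝 μ) := by
    refine tendsto_iff_ultrafilter _ _ _ |>.2 fun U hU => ?_
    obtain ⟨μ', h'⟩ := hex U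
    have : μ' = μ := Subtype.ext (@measure_eq_of_integral_eq _ _ μ'.2 μ.2 fun q f hf =>
      tendsto_nhds_unique (hP U hU μ' h' q f hf) (hμ' q f hf))
    rwa [← this]
  rw [ProbabilityMeasure.tendsto_nhds_iff_toFiniteMeasure_tendsto_nhds] at hlim
  refine (tendsto_add_atTop_iff_nat 1).1 (hlim.congr fun n => ?_)
  exact Subtype.ext rfl

lemma measurePreserving_shift {μ : ProbabilityMeasure Seq}
    (hμ : ∀ q f, IsUnitLocal q f →
      Tendsto (cesaroMean b f) atTop (𝓝 (∫ x, f x ∂(μ : Measure Seq)))) :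
    MeasurePreserving shift (μ : Measure Seq) (μ : Measure Seq) := by
  have : IsProbabilityMeasure ((μ : Measure Seq).map shift) :=
    Measure.isProbabilityMeasure_map measurable_shift.aemeasurable
  refine ⟨measurable_shift, measure_eq_of_integral_eq fun q f hf => ?_⟩
  rw [integral_map measurable_shift.aemeasurable hf.isLocal.measurable.aestronglyMeasurable]
  have h1 := hμ _ _ (hf.comp_shift 1)
  have h2 := hμ _ _ hf
  have h3 (n : ℕ) : cesaroMean b (fun x => f (shift^[1] x)) n
      = cesaroMean b f n + (meanAt b f n - meanAt b f 0) / n := by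
    have e (t : ℕ) : meanAt b (fun x => f (shift^[1] x)) t = meanAt b f (t + 1) := by
      simp only [meanAt, ← Function.iterate_add_apply, add_comm]
    simp only [cesaroMean, e]
    rw [← add_div, Finset.sum_range_succ' (fun t => meanAt b f t) n |>.symm.trans
      (Finset.sum_range_succ _ n) |> eq_sub_of_add_eq]
    ring_nf
  have h4 : Tendsto (fun n : ℕ => (meanAt b f n - meanAt b f 0) / n) atTop (𝓝 0) := by
    refine squeeze_zero_norm (fun n => ?_) (tendsto_const_div_atTop_nhds_zero_nat 1)
    rw [norm_div, Real.norm_natCast]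
    gcongr
    have a1 := hf.meanAt_nonneg b n
    have a2 := hf.meanAt_nonneg b 0
    have a3 := hf.meanAt_le_one b n
    have a4 := hf.meanAt_le_one b 0
    rw [Real.norm_eq_abs, abs_le]
    constructor <;> linarith
  have h5 := h2.add h4
  rw [add_zero] at h5
  exact tendsto_nhds_unique (h1.congr h3) h5

/-! ### Correlations of functions of finitely many coordinates -/

open Classical in
/-- The indicator of the positions that are not among the first `l` positions of a block. -/
noncomputable def offBlock (b : ℕ → ℕ) (k l t : ℕ) : ℝ :=
  if ∃ J, ∃ r < l, t = blockPos b k J + r then 0 else 1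

lemma offBlock_nonneg (b : ℕ → ℕ) (k l t : ℕ) : 0 ≤ offBlock b k l t := by
  unfold offBlock; split_ifs <;> norm_num

lemma offBlock_le_one (b : ℕ → ℕ) (k l t : ℕ) : offBlock b k l t ≤ 1 := by
  unfold offBlock; split_ifs <;> norm_num

/-- A sum over positions is, up to the number of positions outside of blocks, a sum over blocks. -/
lemma sum_le_sum_blocks (hb : ∀ n : ℕ, 1 ≤ n → ∃ k : ℕ, b n = 2 ^ k) {q k l : ℕ} (M : ℕ)
    (hl : l + q = wordLength b k) {F : ℕ → ℝ} (hF : ∀ t, F t ≤ 1) :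
    ∑ t ∈ Finset.range (blockPos b k M), F t
      ≤ ∑ I ∈ Finset.range M, ∑ r ∈ Finset.range l, F (blockPos b k I + r) + M * (q + 1) := by
  have h1 := sum_blocks_le hb k M (F := fun t => 1 - F t) (fun t => sub_nonneg.2 (hF t))
    (l := l) (by omega)
  simp only [Finset.sum_sub_distrib, Finset.sum_const, Finset.card_range, nsmul_eq_mul,
    mul_one] at h1
  have h2 : (blockPos b k M : ℝ) ≤ M * (l + q + 1) := by
    have h3 := blockPos_le hb k M
    have h4 := wordLength_add_one hb k
    rw [← h4, ← hl, mul_comm] at h3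
    exact_mod_cast h3
  linarith

lemma sum_offBlock_le (hb : ∀ n : ℕ, 1 ≤ n → ∃ k : ℕ, b n = 2 ^ k) {q k l : ℕ} (M j : ℕ)
    (hl : l + q = wordLength b k) :
    ∑ t ∈ Finset.range (blockPos b k M), offBlock b k l (t + j) ≤ M * (q + 1) + j := by
  have h1 := sum_le_sum_blocks hb M hl (offBlock_le_one b k l)
  have h2 : ∑ I ∈ Finset.range M, ∑ r ∈ Finset.range l, offBlock b k l (blockPos b k I + r) = 0 :=
    Finset.sum_eq_zero fun I _ => Finset.sum_eq_zero fun r hr =>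
      if_pos ⟨I, r, Finset.mem_range.1 hr, rfl⟩
  rw [h2, zero_add] at h1
  have h3 : ∑ t ∈ Finset.range (blockPos b k M), offBlock b k l (t + j)
      ≤ ∑ t ∈ Finset.range (blockPos b k M + j), offBlock b k l t := by
    rw [add_comm _ j, Finset.sum_range_add]
    simp only [add_comm _ j]
    exact le_add_of_nonneg_left (Finset.sum_nonneg fun _ _ => offBlock_nonneg _ _ _ _)
  have h4 : ∑ t ∈ Finset.range (blockPos b k M + j), offBlock b k l t
      ≤ ∑ t ∈ Finset.range (blockPos b k M), offBlock b k l t + j := by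
    rw [Finset.sum_range_add]
    have : ∑ x ∈ Finset.range j, offBlock b k l (blockPos b k M + x) ≤ ∑ x ∈ Finset.range j, 1 :=
      Finset.sum_le_sum fun _ _ => offBlock_le_one _ _ _ _
    simp at this
    linarith
  linarith

/-- The number of quadruples of a block `I < M`, a later block with the same slot at most `m` blocks
away, and positions `r, r' < l` in them at distance `j`. -/
noncomputable def sameSlotCount (b : ℕ → ℕ) (k M m l j : ℕ) : ℝ :=
  ∑ I ∈ Finset.range M, ∑ r ∈ Finset.range l, ∑ r' ∈ Finset.range l, ∑ D ∈ Finset.range m,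
    if (blockPos b k (I + D) : ℤ) = blockPos b k I + (j + r - r') ∧ slot b k (I + D) = slot b k I
    then 1 else 0

/-- The correlation of `f` at a position of a block with `g` at distance `j`: either the second
position lies outside of blocks, or the two blocks have a common slot, or they are independent. -/
lemma meanAt_mul_le (hb : ∀ n : ℕ, 1 ≤ n → ∃ k : ℕ, b n = 2 ^ k) {q : ℕ} {f g : Seq → ℝ}
    (hf : IsUnitLocal q f) (hg : IsUnitLocal q g) {k l m j : ℕ} (hl : l + q = wordLength b k)
    (hm : l + j ≤ m) (I r : ℕ) (hr : r < l) :
    meanAt b (fun x => f x * g (shift^[j] x)) (blockPos b k I + r)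
      ≤ offBlock b k l (blockPos b k I + r + j)
        + ∑ r' ∈ Finset.range l, ∑ D ∈ Finset.range m,
          if (blockPos b k (I + D) : ℤ) = blockPos b k I + (j + r - r')
          then meanAt b f r * meanAt b g r' + if slot b k (I + D) = slot b k I then 1 else 0
          else 0 := by
  have hterm (r' D : ℕ) : (0 : ℝ) ≤
      if (blockPos b k (I + D) : ℤ) = blockPos b k I + (j + r - r')
      then meanAt b f r * meanAt b g r' + if slot b k (I + D) = slot b k I then 1 else 0
      else 0 := by
    have := mul_nonneg (hf.meanAt_nonneg b r) (hg.meanAt_nonneg b r')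
    split_ifs <;> linarith
  have hle := (hf.mul_comp_shift hg j).meanAt_le_one b (blockPos b k I + r)
  by_cases h : ∃ J, ∃ r' < l, blockPos b k I + r + j = blockPos b k J + r'
  · obtain ⟨J, r', hr', h⟩ := h
    have hIJ : I ≤ J := by
      by_contra hlt
      obtain ⟨D, rfl⟩ := Nat.exists_eq_add_of_le (show J + 1 ≤ I by omega)
      have h1 := blockPos_add_le hb k (J + 1) D
      have h2 := blockPos_succ hb k J
      omega
    obtain ⟨D, rfl⟩ := Nat.exists_eq_add_of_le hIJ
    have hD : D < m := by
      have h1 := blockPos_add_le hb k I D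
      have h2 := Nat.mul_le_mul_right D (Nat.succ_le_of_lt (wordLength_pos hb k))
      omega
    have hhit : (blockPos b k (I + D) : ℤ) = blockPos b k I + (j + r - r') := by omega
    refine le_trans ?_ (le_add_of_nonneg_left (offBlock_nonneg _ _ _ _))
    refine le_trans ?_ (Finset.single_le_sum (fun r' _ => Finset.sum_nonneg fun D _ => hterm r' D)
      (Finset.mem_range.2 hr'))
    refine le_trans ?_ (Finset.single_le_sum (fun D _ => hterm r' D) (Finset.mem_range.2 hD))
    rw [if_pos hhit]
    split_ifs with hs
    · have := mul_nonneg (hf.meanAt_nonneg b r) (hg.meanAt_nonneg b r')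
      linarith
    · rw [add_zero, ← integral_mul_of_slot_ne hb hf.isLocal hg.isLocal (k := k) (I := I)
        (J := I + D) (by omega) (by omega) (Ne.symm hs), ← h]
      simp only [meanAt, ← Function.iterate_add_apply]
      rw [add_comm j]
  · have : offBlock b k l (blockPos b k I + r + j) = 1 := if_neg h
    rw [this]
    exact hle.trans (le_add_of_nonneg_right
      (Finset.sum_nonneg fun r' _ => Finset.sum_nonneg fun D _ => hterm r' D))

lemma sum_meanAt_mul_le (hb : ∀ n : ℕ, 1 ≤ n → ∃ k : ℕ, b n = 2 ^ k) {q : ℕ} {f g : Seq → ℝ}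
    (hf : IsUnitLocal q f) (hg : IsUnitLocal q g) {k l m j : ℕ} (hl : l + q = wordLength b k)
    (hm : l + j ≤ m) (L : ℕ) :
    ∑ t ∈ Finset.range (blockPos b k (2 ^ L)), meanAt b (fun x => f x * g (shift^[j] x)) t
      ≤ 2 ^ L * ∑ r ∈ Finset.range l, ∑ r' ∈ Finset.range l,
          meanAt b f r * meanAt b g r' * hitFreq b k L m (j + r - r')
        + sameSlotCount b k (2 ^ L) m l j + 2 ^ L * (2 * (q + 1)) + j := by
  have h1 := sum_le_sum_blocks hb (2 ^ L) hl ((hf.mul_comp_shift hg j).meanAt_le_one b)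
  have h2 := Finset.sum_le_sum fun I (_ : I ∈ Finset.range (2 ^ L)) =>
    Finset.sum_le_sum fun r hr => meanAt_mul_le hb hf hg hl hm I r (Finset.mem_range.1 hr)
  have h3 := sum_blocks_le hb k (2 ^ L) (F := fun t => offBlock b k l (t + j))
    (fun t => offBlock_nonneg _ _ _ _) (l := l) (by omega)
  have h4 := sum_offBlock_le hb (2 ^ L) j hl
  simp only [Finset.sum_add_distrib] at h2
  have h5 : ∑ I ∈ Finset.range (2 ^ L), ∑ r ∈ Finset.range l, ∑ r' ∈ Finset.range l,
      ∑ D ∈ Finset.range m, (if (blockPos b k (I + D) : ℤ) = blockPos b k I + (j + r - r')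
        then meanAt b f r * meanAt b g r' + (if slot b k (I + D) = slot b k I then 1 else 0)
        else 0)
      = 2 ^ L * ∑ r ∈ Finset.range l, ∑ r' ∈ Finset.range l,
          meanAt b f r * meanAt b g r' * hitFreq b k L m (j + r - r')
        + sameSlotCount b k (2 ^ L) m l j := by
    have e (I r r' D : ℕ) : (if (blockPos b k (I + D) : ℤ) = blockPos b k I + (j + r - r')
        then meanAt b f r * meanAt b g r' + (if slot b k (I + D) = slot b k I then 1 else 0)
        else 0)
        = meanAt b f r * meanAt b g r' *
            (if (blockPos b k (I + D) : ℤ) = blockPos b k I + (j + r - r') then 1 else 0)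
          + if (blockPos b k (I + D) : ℤ) = blockPos b k I + (j + r - r')
              ∧ slot b k (I + D) = slot b k I then 1 else 0 := by
      split_ifs <;> simp_all
    simp only [e, Finset.sum_add_distrib, sameSlotCount]
    congr 1
    rw [Finset.sum_comm, Finset.mul_sum]
    refine Finset.sum_congr rfl fun r _ => ?_
    rw [Finset.sum_comm, Finset.mul_sum]
    refine Finset.sum_congr rfl fun r' _ => ?_
    simp only [hitFreq, ← Finset.mul_sum]
    field_simp
  push_cast at h1 h4
  rw [h5] at h2
  linarith

lemma sum_sameSlotCount_le {k m : ℕ} {K : ℝ}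
    (hK : ∀ v x, (((Finset.Ico x (x + m)).filter fun J => slot b k J = v).card : ℝ) ≤ K)
    (M l n : ℕ) :
    ∑ j ∈ Finset.range n, sameSlotCount b k M m l j ≤ M * (l ^ 2 * K) := by
  have h1 (I r r' : ℕ) : ∑ j ∈ Finset.range n, ∑ D ∈ Finset.range m,
      (if (blockPos b k (I + D) : ℤ) = blockPos b k I + (j + r - r')
        ∧ slot b k (I + D) = slot b k I then (1 : ℝ) else 0) ≤ K := by
    rw [Finset.sum_comm]
    have h2 (D : ℕ) : ∑ j ∈ Finset.range n,
        (if (blockPos b k (I + D) : ℤ) = blockPos b k I + (j + r - r')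
          ∧ slot b k (I + D) = slot b k I then (1 : ℝ) else 0)
        ≤ if slot b k (I + D) = slot b k I then 1 else 0 := by
      split_ifs with hs
      · simp only [hs, and_true]
        refine (le_abs_self _).trans (le_trans (le_of_eq ?_) (abs_sum_ite_eq_le n (fun _ => 1)
          (by simp) ((blockPos b k (I + D) : ℤ) - blockPos b k I - r + r')))
        congr 1
        refine Finset.sum_congr rfl fun j _ => if_congr ?_ rfl rfl
        omega
      · simp [hs]
    refine (Finset.sum_le_sum fun D _ => h2 D).trans ?_
    rw [Finset.sum_boole]
    refine le_trans ?_ (hK (slot b k I) I)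
    rw [Nat.cast_le]
    refine Finset.card_le_card_of_injOn (fun D => I + D) (fun D hD => ?_)
      (fun _ _ _ _ h => Nat.add_left_cancel h)
    simp only [Finset.coe_filter, Finset.mem_range, Set.mem_ofPred_eq, Finset.mem_Ico] at hD ⊢
    exact ⟨⟨by omega, by omega⟩, hD.2⟩
  simp only [sameSlotCount]
  rw [Finset.sum_comm]
  have h3 (I : ℕ) : ∑ j ∈ Finset.range n, ∑ r ∈ Finset.range l, ∑ r' ∈ Finset.range l,
      ∑ D ∈ Finset.range m, (if (blockPos b k (I + D) : ℤ) = blockPos b k I + (j + r - r')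
        ∧ slot b k (I + D) = slot b k I then (1 : ℝ) else 0) ≤ l ^ 2 * K := by
    rw [Finset.sum_comm]
    have h4 (r : ℕ) : ∑ j ∈ Finset.range n, ∑ r' ∈ Finset.range l,
        ∑ D ∈ Finset.range m, (if (blockPos b k (I + D) : ℤ) = blockPos b k I + (j + r - r')
          ∧ slot b k (I + D) = slot b k I then (1 : ℝ) else 0) ≤ l * K := by
      rw [Finset.sum_comm]
      refine (Finset.sum_le_sum fun r' _ => h1 I r r').trans ?_
      simp
    refine (Finset.sum_le_sum fun r _ => h4 r).trans (le_of_eq ?_)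
    simp
    ring
  refine (Finset.sum_le_sum fun I _ => h3 I).trans (le_of_eq ?_)
  simp

/-- Translating the argument of a nonnegative function that vanishes at negative arguments. -/
lemma sum_translate_le {w : ℤ → ℝ} (hw : ∀ d, 0 ≤ w d) (hw0 : ∀ d < 0, w d = 0) (n l : ℕ) {e : ℤ}
    (he : e ≤ l) :
    ∑ j ∈ Finset.range n, w (j + e) ≤ ∑ d ∈ Finset.range (n + l), w d := by
  rcases le_total 0 e with h | h
  · lift e to ℕ using h
    have h1 : ∑ j ∈ Finset.range n, w ((j : ℤ) + e) = ∑ j ∈ Finset.range n, w ((e + j : ℕ) : ℤ) :=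
      Finset.sum_congr rfl fun j _ => by push_cast; rw [add_comm]
    have h2 := Finset.sum_range_add (fun d : ℕ => w (d : ℤ)) e n
    have h3 : ∑ d ∈ Finset.range (e + n), w (d : ℤ) ≤ ∑ d ∈ Finset.range (n + l), w (d : ℤ) :=
      Finset.sum_le_sum_of_subset_of_nonneg (Finset.range_subset_range.2 (by omega))
        fun _ _ _ => hw _
    have h4 : 0 ≤ ∑ d ∈ Finset.range e, w (d : ℤ) := Finset.sum_nonneg fun _ _ => hw _
    rw [h1]
    linarith
  · obtain ⟨i, rfl⟩ := Int.exists_eq_neg_ofNat h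
    have h1 : ∑ j ∈ Finset.range n, w ((j : ℤ) + -i)
        ≤ ∑ j ∈ Finset.range (i + n), w ((j : ℤ) + -i) :=
      Finset.sum_le_sum_of_subset_of_nonneg (Finset.range_subset_range.2 (by omega))
        fun _ _ _ => hw _
    have hz : ∑ j ∈ Finset.range i, w ((j : ℤ) + -i) = 0 :=
      Finset.sum_eq_zero fun j hj => hw0 _ (by have := Finset.mem_range.1 hj; omega)
    rw [Finset.sum_range_add, hz, zero_add] at h1
    refine h1.trans ?_
    have h2 : ∑ x ∈ Finset.range n, w (((i + x : ℕ) : ℤ) + -i) = ∑ x ∈ Finset.range n, w (x : ℤ) :=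
      Finset.sum_congr rfl fun x _ => by congr 1; push_cast; ring
    rw [h2]
    exact Finset.sum_le_sum_of_subset_of_nonneg (Finset.range_subset_range.2 (by omega))
        fun _ _ _ => hw _

lemma hitFreq_of_neg (hb : ∀ n : ℕ, 1 ≤ n → ∃ k : ℕ, b n = 2 ^ k) (k L m : ℕ) {d : ℤ} (hd : d < 0) :
    hitFreq b k L m d = 0 := by
  rw [hitFreq, Finset.sum_eq_zero, zero_div]
  intro I _
  refine Finset.sum_eq_zero fun D _ => if_neg ?_
  have := blockPos_add_le hb k I D
  omega

lemma sum_meanAt_le (hb : ∀ n : ℕ, 1 ≤ n → ∃ k : ℕ, b n = 2 ^ k) {q : ℕ} {f : Seq → ℝ}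
    (hf : IsUnitLocal q f) {c : ℝ} (hc : Tendsto (cesaroMean b f) atTop (𝓝 c)) {k l : ℕ}
    (hl : l + q = wordLength b k) :
    ∑ r ∈ Finset.range l, meanAt b f r ≤ (wordLength b k + 1) * c := by
  have hE : (wordLength b k + 1 : ℝ) = 2 * letterCount b k := by
    exact_mod_cast wordLength_add_one hb k
  have hE0 : (0 : ℝ) < wordLength b k + 1 := by positivity
  rw [← div_le_iff₀' hE0, hE]
  refine le_of_forall_pos_sub_le fun ε hε => ?_
  exact ge_of_tendsto hc (eventually_le_cesaroMean hb hf hl.le hε)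

/-- One level `k` of blocks bounds the excess of the correlations over the product of the means, up
to an error that is small with respect to `n` if the words of level `k` are long. -/
lemma sum_excess_le (hb : ∀ n : ℕ, 1 ≤ n → ∃ k : ℕ, b n = 2 ^ k) {q : ℕ} {f g : Seq → ℝ}
    (hf : IsUnitLocal q f) (hg : IsUnitLocal q g) {μ : ProbabilityMeasure Seq}
    (hμ : ∀ q f, IsUnitLocal q f →
      Tendsto (cesaroMean b f) atTop (𝓝 (∫ x, f x ∂(μ : Measure Seq))))
    {k l n L₀ : ℕ} (hl : l + q = wordLength b k) {W K : ℝ}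
    (hW : ∀ L ≥ L₀, ∑ d ∈ Finset.range (n + l),
      max 0 (hitFreq b k L (n + l) d - 1 / wordLength b k) ≤ W)
    (hK : ∀ v x, (((Finset.Ico x (x + (n + l))).filter fun J => slot b k J = v).card : ℝ) ≤ K) :
    ∑ j ∈ Finset.range n, max 0 (∫ x, f x * g (shift^[j] x) ∂(μ : Measure Seq)
        - (∫ x, f x ∂(μ : Measure Seq)) * ∫ x, g x ∂(μ : Measure Seq))
      ≤ (n * (2 * q + 5) + l ^ 2 * (W + K)) / wordLength b k := by
  set A := ∫ x, f x ∂(μ : Measure Seq) with hA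
  set B := ∫ x, g x ∂(μ : Measure Seq) with hB
  set a := wordLength b k with ha
  have ha0 : (0 : ℝ) < a := by exact_mod_cast wordLength_pos hb k
  have ha1 : (1 : ℝ) ≤ a := by exact_mod_cast wordLength_pos hb k
  have hA0 : 0 ≤ A := integral_nonneg hf.nonneg
  have hB0 : 0 ≤ B := integral_nonneg hg.nonneg
  have hA1 : A ≤ 1 := by
    have := hf.integral_one_sub (μ : Measure Seq)
    have h2 : 0 ≤ ∫ x, (1 - f x) ∂(μ : Measure Seq) := integral_nonneg hf.one_sub.nonneg
    linarith
  have hB1 : B ≤ 1 := by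
    have := hg.integral_one_sub (μ : Measure Seq)
    have h2 : 0 ≤ ∫ x, (1 - g x) ∂(μ : Measure Seq) := integral_nonneg hg.one_sub.nonneg
    linarith
  have hAB1 : A * B ≤ 1 := mul_le_one₀ hA1 hB0 hB1
  have hAB0 : 0 ≤ A * B := mul_nonneg hA0 hB0
  have hfA := sum_meanAt_le hb hf (hμ _ _ hf) hl
  have hgB := sum_meanAt_le hb hg (hμ _ _ hg) hl
  rw [← hA, ← ha] at hfA
  rw [← hB, ← ha] at hgB
  -- along the positions at which a block with index `2 ^ L` starts
  let X : ℕ → ℕ → ℝ := fun L j =>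
    cesaroMean b (fun x => f x * g (shift^[j] x)) (blockPos b k (2 ^ L))
  have hpos (M : ℕ) : a * M ≤ blockPos b k M := by
    have := blockPos_add_le hb k 0 M
    rwa [blockPos_zero, zero_add, zero_add] at this
  have hXlim (j : ℕ) : Tendsto (fun L => X L j) atTop
      (𝓝 (∫ x, f x * g (shift^[j] x) ∂(μ : Measure Seq))) := by
    refine (hμ _ _ (hf.mul_comp_shift hg j)).comp ?_
    refine tendsto_atTop_mono (fun L => ?_) tendsto_id
    exact (Nat.lt_two_pow_self (n := L)).le.trans
      ((Nat.le_mul_of_pos_left _ (wordLength_pos hb k)).trans (hpos (2 ^ L)))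
  have hbound : ∀ L ≥ L₀, ∑ j ∈ Finset.range n, max 0 (X L j - A * B)
      ≤ (n * (2 * q + 5) + l ^ 2 * (W + K) + n * n * (1 / 2) ^ L) / a := by
    intro L hL
    have hM : (0 : ℝ) < 2 ^ L := by positivity
    set w : ℤ → ℝ := fun d => max 0 (hitFreq b k L (n + l) d - 1 / a) with hw
    have hw0 (d : ℤ) : 0 ≤ w d := le_max_left _ _
    have hterm : ∀ j ∈ Finset.range n, max 0 (X L j - A * B)
        ≤ ((2 * q + 5 + ∑ r ∈ Finset.range l, ∑ r' ∈ Finset.range l, w (j + (r - r'))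
          + sameSlotCount b k (2 ^ L) (n + l) l j / 2 ^ L) + n * (1 / 2) ^ L) / a := by
      intro j hj
      have hj := Finset.mem_range.1 hj
      have hs0 : 0 ≤ sameSlotCount b k (2 ^ L) (n + l) l j := by
        unfold sameSlotCount
        refine Finset.sum_nonneg fun _ _ => Finset.sum_nonneg fun _ _ =>
          Finset.sum_nonneg fun _ _ => Finset.sum_nonneg fun _ _ => ?_
        split_ifs <;> norm_num
      have hww0 : 0 ≤ ∑ r ∈ Finset.range l, ∑ r' ∈ Finset.range l, w (j + ((r : ℤ) - r')) :=
        Finset.sum_nonneg fun _ _ => Finset.sum_nonneg fun _ _ => hw0 _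
      refine max_le (by positivity) ?_
      have h1 := sum_meanAt_mul_le hb hf hg hl (show l + j ≤ n + l by omega) L
      have h2 : ∑ r ∈ Finset.range l, ∑ r' ∈ Finset.range l,
          meanAt b f r * meanAt b g r' * hitFreq b k L (n + l) (j + r - r')
          ≤ (a + 1) * A * ((a + 1) * B) * (1 / a)
            + ∑ r ∈ Finset.range l, ∑ r' ∈ Finset.range l, w (j + (r - r')) := by
        have h3 : ∀ r ∈ Finset.range l, ∀ r' ∈ Finset.range l,
            meanAt b f r * meanAt b g r' * hitFreq b k L (n + l) (j + r - r')
            ≤ meanAt b f r * meanAt b g r' * (1 / a) + w (j + (r - r')) := by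
          intro r _ r' _
          have h4 : hitFreq b k L (n + l) (j + r - r') ≤ 1 / a + w (j + (r - r')) := by
            have := le_max_right 0 (hitFreq b k L (n + l) (j + (r - r')) - 1 / a)
            rw [← add_sub_assoc] at this
            simp only [hw]
            rw [← add_sub_assoc]
            linarith
          have h5 : 0 ≤ meanAt b f r * meanAt b g r' :=
            mul_nonneg (hf.meanAt_nonneg b r) (hg.meanAt_nonneg b r')
          have h6 : meanAt b f r * meanAt b g r' ≤ 1 :=
            mul_le_one₀ (hf.meanAt_le_one b r) (hg.meanAt_nonneg b r') (hg.meanAt_le_one b r')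
          have h7 := mul_le_mul_of_nonneg_left h4 h5
          have h8 := mul_le_mul_of_nonneg_right h6 (hw0 (j + (r - r')))
          linarith
        refine (Finset.sum_le_sum fun r hr => Finset.sum_le_sum fun r' hr' =>
          h3 r hr r' hr').trans ?_
        simp only [Finset.sum_add_distrib, ← Finset.sum_mul, ← Finset.mul_sum]
        have h9 : 0 ≤ ∑ r ∈ Finset.range l, meanAt b g r :=
          Finset.sum_nonneg fun r _ => hg.meanAt_nonneg b r
        gcongr
      have h3 : (a + 1) * A * ((a + 1) * B) * (1 / a) ≤ a * (A * B) + 3 := by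
        have e : (a + 1) * A * ((a + 1) * B) * (1 / a) = a * (A * B) + (2 + 1 / a) * (A * B) := by
          field_simp; ring
        have h4 : (1 : ℝ) / a ≤ 1 := (div_le_one ha0).2 ha1
        have h5 : (2 + 1 / (a : ℝ)) * (A * B) ≤ 3 * 1 :=
          mul_le_mul (by linarith) hAB1 hAB0 (by norm_num)
        linarith
      have h4 : X L j ≤ (∑ t ∈ Finset.range (blockPos b k (2 ^ L)),
          meanAt b (fun x => f x * g (shift^[j] x)) t) / (a * 2 ^ L) := by
        refine div_le_div_of_nonneg_left (Finset.sum_nonneg fun t _ =>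
          (hf.mul_comp_shift hg j).meanAt_nonneg b t) (by positivity) ?_
        exact_mod_cast hpos (2 ^ L)
      have h5 : (∑ t ∈ Finset.range (blockPos b k (2 ^ L)),
          meanAt b (fun x => f x * g (shift^[j] x)) t) ≤
          2 ^ L * (a * (A * B) + (2 * q + 5
            + ∑ r ∈ Finset.range l, ∑ r' ∈ Finset.range l, w (j + (r - r'))
            + sameSlotCount b k (2 ^ L) (n + l) l j / 2 ^ L + n * (1 / 2) ^ L)) := by
        have h6 := mul_le_mul_of_nonneg_left (h2.trans (add_le_add_left h3 _)) hM.le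
        have h7 : (2 : ℝ) ^ L * (sameSlotCount b k (2 ^ L) (n + l) l j / 2 ^ L)
            = sameSlotCount b k (2 ^ L) (n + l) l j := by field_simp
        have h8 : (2 : ℝ) ^ L * (n * (1 / 2) ^ L) = n := by
          rw [mul_left_comm, ← mul_pow]; norm_num
        have h9 : (j : ℝ) ≤ n := by exact_mod_cast hj.le
        simp only [mul_add] at h6 ⊢
        rw [h7, h8]
        linarith
      rw [le_div_iff₀ ha0, sub_mul, sub_le_iff_le_add]
      have h6 := (le_div_iff₀ (by positivity : (0 : ℝ) < a * 2 ^ L)).1 h4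
      have h7 : 2 ^ L * (X L j * a) ≤ 2 ^ L * (a * (A * B) + (2 * q + 5
            + ∑ r ∈ Finset.range l, ∑ r' ∈ Finset.range l, w (j + (r - r'))
            + sameSlotCount b k (2 ^ L) (n + l) l j / 2 ^ L + n * (1 / 2) ^ L)) := by
        linarith
      have h8 := le_of_mul_le_mul_left h7 hM
      linarith
    refine (Finset.sum_le_sum hterm).trans ?_
    rw [← Finset.sum_div]
    refine div_le_div_of_nonneg_right ?_ ha0.le
    simp only [Finset.sum_add_distrib, Finset.sum_const, Finset.card_range, nsmul_eq_mul]
    have hws : ∑ j ∈ Finset.range n, ∑ r ∈ Finset.range l, ∑ r' ∈ Finset.range l,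
        w (j + ((r : ℤ) - r')) ≤ l ^ 2 * W := by
      have h1 : ∀ r ∈ Finset.range l, ∀ r' ∈ Finset.range l,
          ∑ j ∈ Finset.range n, w (j + ((r : ℤ) - r')) ≤ W := by
        intro r hr r' _
        have := Finset.mem_range.1 hr
        refine (sum_translate_le hw0 (fun d hd => ?_) n l (by omega)).trans (hW L hL)
        simp only [hw]
        rw [hitFreq_of_neg hb k L _ hd, zero_sub]
        exact max_eq_left (by have : (0 : ℝ) < 1 / a := by positivity
                              linarith)
      rw [Finset.sum_comm]
      have h2 : ∀ r ∈ Finset.range l, ∑ j ∈ Finset.range n, ∑ r' ∈ Finset.range l,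
          w (j + ((r : ℤ) - r')) ≤ l * W := by
        intro r hr
        rw [Finset.sum_comm]
        refine (Finset.sum_le_sum fun r' hr' => h1 r hr r' hr').trans (le_of_eq ?_)
        simp
      refine (Finset.sum_le_sum h2).trans (le_of_eq ?_)
      simp
      ring
    have hss := sum_sameSlotCount_le hK (2 ^ L) l n
    rw [← Finset.sum_div]
    have hss' : (∑ j ∈ Finset.range n, sameSlotCount b k (2 ^ L) (n + l) l j) / 2 ^ L
        ≤ l ^ 2 * K := by
      rw [div_le_iff₀ hM, mul_comm]
      exact_mod_cast hss
    linarith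
  have hl1 : Tendsto (fun L => ∑ j ∈ Finset.range n, max 0 (X L j - A * B)) atTop
      (𝓝 (∑ j ∈ Finset.range n, max 0 (∫ x, f x * g (shift^[j] x) ∂(μ : Measure Seq) - A * B))) :=
    tendsto_finsetSum _ fun j _ => tendsto_const_nhds.max ((hXlim j).sub_const _)
  have hl2 : Tendsto (fun L : ℕ =>
      ((n : ℝ) * (2 * q + 5) + l ^ 2 * (W + K) + n * n * (1 / 2) ^ L) / a) atTop
      (𝓝 ((n * (2 * q + 5) + l ^ 2 * (W + K) + n * n * 0) / a)) :=
    (((tendsto_pow_atTop_nhds_zero_of_lt_one (by norm_num : (0 : ℝ) ≤ 1 / 2)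
      (by norm_num)).const_mul _).const_add _).div_const _
  rw [mul_zero, add_zero] at hl2
  exact le_of_tendsto_of_tendsto hl1 hl2 (eventually_atTop.2 ⟨L₀, hbound⟩)

lemma exists_sum_excess_le (hb : ∀ n : ℕ, 1 ≤ n → ∃ k : ℕ, b n = 2 ^ k)
    (hlim : Tendsto (fun n : ℕ => (b (n + 1) : ℝ) / ∏ i ∈ Finset.Icc 1 n, (b i : ℝ)) atTop atTop)
    {q : ℕ} {f g : Seq → ℝ} (hf : IsUnitLocal q f) (hg : IsUnitLocal q g)
    {μ : ProbabilityMeasure Seq}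
    (hμ : ∀ q f, IsUnitLocal q f →
      Tendsto (cesaroMean b f) atTop (𝓝 (∫ x, f x ∂(μ : Measure Seq)))) {ε : ℝ} (hε : 0 < ε) :
    ∃ n₀, ∀ n ≥ n₀, ∑ j ∈ Finset.range n, max 0 (∫ x, f x * g (shift^[j] x) ∂(μ : Measure Seq)
        - (∫ x, f x ∂(μ : Measure Seq)) * ∫ x, g x ∂(μ : Measure Seq)) ≤ ε * n := by
  obtain ⟨k₀, hk₀⟩ := exists_nat_gt ((2 * q + 5) / (ε / 4))
  set k := k₀ + q
  have hk : k ≤ wordLength b k := (wordLength_strictMono hb).le_apply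
  obtain ⟨l, hl⟩ := Nat.exists_eq_add_of_le' (show q ≤ wordLength b k by omega)
  set a := wordLength b k with ha
  have ha0 : (0 : ℝ) < a := by exact_mod_cast wordLength_pos hb k
  have hla : (l : ℝ) ≤ a := by exact_mod_cast (by omega : l ≤ a)
  have h1 : (2 * q + 5 : ℝ) ≤ ε / 4 * a := by
    rw [div_lt_iff₀ (by positivity)] at hk₀
    have : (k₀ : ℝ) ≤ a := by exact_mod_cast (by omega : k₀ ≤ a)
    nlinarith
  obtain ⟨n₁, hn₁⟩ := exists_sum_hitFreq_excess_le hb k (show 0 < ε / (8 * a) by positivity)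
  obtain ⟨r, hr⟩ := exists_le_prod hb hlim k (8 * a / ε)
  obtain ⟨C, hC⟩ := exists_card_slot_eq_le hb r k
  set P : ℝ := ((∏ i ∈ Finset.range r, b (k + i + 1) : ℕ) : ℝ) with hP
  have hP0 : 0 < P := lt_of_lt_of_le (by positivity) hr
  obtain ⟨n₂, hn₂⟩ := exists_nat_gt (4 * a * C / ε)
  refine ⟨max (max n₁ n₂) l, fun n hn => ?_⟩
  simp only [max_le_iff, ge_iff_le] at hn
  obtain ⟨L₀, hL₀⟩ := hn₁ (n + l) (by omega)
  have hmain := sum_excess_le hb hf hg hμ hl.symm hL₀ (K := ((n + l : ℕ) : ℝ) / P + C)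
    fun v x => hC v x (n + l)
  refine hmain.trans ?_
  rw [← ha, div_le_iff₀ ha0]
  have hnl : ((n + l : ℕ) : ℝ) ≤ 2 * n := by exact_mod_cast (by omega : n + l ≤ 2 * n)
  have hn0 : (0 : ℝ) ≤ n := Nat.cast_nonneg n
  have h2 : ε / (8 * a) * ((n + l : ℕ) : ℝ) ≤ ε * n / (4 * a) := by
    have := mul_le_mul_of_nonneg_left hnl (by positivity : 0 ≤ ε / (8 * a))
    have e : ε / (8 * a) * (2 * n) = ε * n / (4 * a) := by field_simp; ring
    linarith
  have h3 : ((n + l : ℕ) : ℝ) / P ≤ ε * n / (4 * a) := by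
    rw [div_le_iff₀ hP0]
    have h4 := mul_le_mul_of_nonneg_left hr (by positivity : 0 ≤ ε * n / (4 * a))
    have e : ε * n / (4 * a) * (8 * a / ε) = 2 * n := by field_simp; ring
    linarith
  have h4 : C ≤ ε * n / (4 * a) := by
    rw [le_div_iff₀ (by positivity)]
    have h5 : 4 * a * C / ε ≤ n := hn₂.le.trans (by exact_mod_cast hn.1.2)
    rw [div_le_iff₀ hε] at h5
    linarith
  have h5 : (l : ℝ) ^ 2 ≤ a ^ 2 := by gcongr
  have h6 : (l : ℝ) ^ 2 * (ε / (8 * a) * ((n + l : ℕ) : ℝ) + (((n + l : ℕ) : ℝ) / P + C))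
      ≤ a ^ 2 * (3 * (ε * n / (4 * a))) :=
    (mul_le_mul_of_nonneg_left (by linarith : _ ≤ 3 * (ε * n / (4 * a))) (by positivity)).trans
      (mul_le_mul_of_nonneg_right h5 (by positivity))
  have e : (a : ℝ) ^ 2 * (3 * (ε * n / (4 * a))) = 3 / 4 * (ε * n * a) := by field_simp
  have h7 := mul_le_mul_of_nonneg_left h1 hn0
  linarith

/-- Weak mixing for functions of finitely many coordinates: the bound from above, applied to `g`
and to `1 - g`, controls the absolute values of the differences. -/
lemma exists_sum_abs_le (hb : ∀ n : ℕ, 1 ≤ n → ∃ k : ℕ, b n = 2 ^ k)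
    (hlim : Tendsto (fun n : ℕ => (b (n + 1) : ℝ) / ∏ i ∈ Finset.Icc 1 n, (b i : ℝ)) atTop atTop)
    {q : ℕ} {f g : Seq → ℝ} (hf : IsUnitLocal q f) (hg : IsUnitLocal q g)
    {μ : ProbabilityMeasure Seq}
    (hμ : ∀ q f, IsUnitLocal q f →
      Tendsto (cesaroMean b f) atTop (𝓝 (∫ x, f x ∂(μ : Measure Seq)))) {ε : ℝ} (hε : 0 < ε) :
    ∃ n₀, ∀ n ≥ n₀, ∑ j ∈ Finset.range n, |∫ x, f x * g (shift^[j] x) ∂(μ : Measure Seq)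
        - (∫ x, f x ∂(μ : Measure Seq)) * ∫ x, g x ∂(μ : Measure Seq)| ≤ ε * n := by
  obtain ⟨n₁, h1⟩ := exists_sum_excess_le hb hlim hf hg hμ (half_pos hε)
  obtain ⟨n₂, h2⟩ := exists_sum_excess_le hb hlim hf hg.one_sub hμ (half_pos hε)
  refine ⟨max n₁ n₂, fun n hn => ?_⟩
  have h3 := h1 n (le_of_max_le_left hn)
  have h4 := h2 n (le_of_max_le_right hn)
  have e (j : ℕ) : ∫ x, f x * (1 - g (shift^[j] x)) ∂(μ : Measure Seq)
      - (∫ x, f x ∂(μ : Measure Seq)) * ∫ x, (1 - g x) ∂(μ : Measure Seq)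
      = -(∫ x, f x * g (shift^[j] x) ∂(μ : Measure Seq)
        - (∫ x, f x ∂(μ : Measure Seq)) * ∫ x, g x ∂(μ : Measure Seq)) := by
    have : ∫ x, f x * (1 - g (shift^[j] x)) ∂(μ : Measure Seq)
        = ∫ x, f x ∂(μ : Measure Seq) - ∫ x, f x * g (shift^[j] x) ∂(μ : Measure Seq) := by
      rw [← integral_sub (hf.integrable _) ((hf.mul_comp_shift hg j).integrable _)]
      simp only [mul_sub, mul_one]
    rw [this, hg.integral_one_sub]
    ring
  simp only [e] at h4
  have h5 (y : ℝ) : |y| = max 0 y + max 0 (-y) := by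
    rcases le_total 0 y with h | h
    · rw [abs_of_nonneg h, max_eq_right h, max_eq_left (by linarith), add_zero]
    · rw [abs_of_nonpos h, max_eq_left h, max_eq_right (by linarith), zero_add]
  simp only [h5, Finset.sum_add_distrib]
  linarith

/-! ### Weak mixing -/

lemma exists_isUnitLocal_approx (μ : Measure Seq) [IsProbabilityMeasure μ] {B : Set Seq}
    (hB : MeasurableSet B) {δ : ℝ} (hδ : 0 < δ) :
    ∃ q, ∃ B' : Set Seq, MeasurableSet B' ∧ IsUnitLocal q (B'.indicator fun _ => (1 : ℝ)) ∧
      μ.real (B' ∆ B) < δ := by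
  obtain ⟨B', hB', h⟩ := exists_measure_symmDiff_lt_of_generateFrom_isSetRing (μ := μ)
    (isSetRing_measurableCylinders (α := fun _ : ℕ => Letter))
    ⟨{Set.univ}, Set.countable_singleton _,
      Set.singleton_subset_iff.2 (univ_mem_measurableCylinders _), by simp⟩
    generateFrom_measurableCylinders.symm hB (ε := ENNReal.ofReal δ) (by simpa using hδ)
  have hm := MeasurableSet.of_mem_measurableCylinders hB'
  rw [measurableCylinders_nat] at hB'
  simp only [Set.mem_iUnion, Set.mem_singleton_iff] at hB'
  obtain ⟨q, S, -, rfl⟩ := hB'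
  refine ⟨q + 1, _, hm, isUnitLocal_indicator fun x y hxy => ?_, ?_⟩
  · have : (Finset.Iic q).restrict x = (Finset.Iic q).restrict y := by
      funext i
      have := Finset.mem_Iic.1 i.2
      exact hxy i (by omega)
    rw [mem_cylinder, mem_cylinder, this]
  · rw [measureReal_def]
    exact ENNReal.toReal_lt_of_lt_ofReal h

lemma abs_measureReal_sub_le (μ : Measure Seq) [IsProbabilityMeasure μ] (s t : Set Seq) :
    |μ.real s - μ.real t| ≤ μ.real (s ∆ t) := by
  have key (s t : Set Seq) : μ.real s ≤ μ.real t + μ.real (s ∆ t) := by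
    refine (measureReal_mono fun x hx => ?_).trans (measureReal_union_le t (s ∆ t))
    by_cases h : x ∈ t
    · exact Or.inl h
    · exact Or.inr (Or.inl ⟨hx, h⟩)
  have h1 := key s t
  have h2 := key t s
  rw [symmDiff_comm] at h2
  rw [abs_le]
  constructor <;> linarith

lemma isWeaklyMixing_of_tendsto (hb : ∀ n : ℕ, 1 ≤ n → ∃ k : ℕ, b n = 2 ^ k)
    (hlim : Tendsto (fun n : ℕ => (b (n + 1) : ℝ) / ∏ i ∈ Finset.Icc 1 n, (b i : ℝ)) atTop atTop)
    {μ : ProbabilityMeasure Seq}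
    (hμ : ∀ q f, IsUnitLocal q f →
      Tendsto (cesaroMean b f) atTop (𝓝 (∫ x, f x ∂(μ : Measure Seq)))) :
    IsWeaklyMixing shift μ := by
  have hshift := measurePreserving_shift hμ
  refine ⟨hshift, fun B C hB hC => ?_⟩
  set m : Measure Seq := (μ : Measure Seq) with hm
  rw [Metric.tendsto_atTop]
  intro ε hε
  obtain ⟨q₁, B', hB', hf, hBB⟩ := exists_isUnitLocal_approx m hB (show 0 < ε / 16 by positivity)
  obtain ⟨q₂, C', hC', hg, hCC⟩ := exists_isUnitLocal_approx m hC (show 0 < ε / 16 by positivity)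
  have hf' : IsUnitLocal (max q₁ q₂) (B'.indicator fun _ => (1 : ℝ)) :=
    ⟨hf.isLocal.mono (le_max_left _ _), hf.nonneg, hf.le_one⟩
  have hg' : IsUnitLocal (max q₁ q₂) (C'.indicator fun _ => (1 : ℝ)) :=
    ⟨hg.isLocal.mono (le_max_right _ _), hg.nonneg, hg.le_one⟩
  obtain ⟨n₀, hn₀⟩ := exists_sum_abs_le hb hlim hf' hg' hμ (show 0 < ε / 4 by positivity)
  have hint (j : ℕ) : ∫ x, B'.indicator (fun _ => (1 : ℝ)) x
      * C'.indicator (fun _ => (1 : ℝ)) (shift^[j] x) ∂m = m.real (B' ∩ shift^[j] ⁻¹' C') := by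
    rw [← integral_indicator_one (hB'.inter (measurable_shift.iterate j hC'))]
    refine integral_congr_ae (ae_of_all _ fun x => ?_)
    by_cases h1 : x ∈ B' <;> by_cases h2 : shift^[j] x ∈ C' <;> simp [Set.indicator, h1, h2]
  simp only [← hm, hint, integral_indicator_const _ hB', integral_indicator_const _ hC',
    smul_eq_mul, mul_one] at hn₀
  have hterm (j : ℕ) : |m.real (B ∩ shift^[j] ⁻¹' C) - m.real B * m.real C|
      ≤ |m.real (B' ∩ shift^[j] ⁻¹' C') - m.real B' * m.real C'| + ε / 4 := by
    have h1 : |m.real (B' ∩ shift^[j] ⁻¹' C') - m.real (B ∩ shift^[j] ⁻¹' C)|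
        ≤ ε / 8 := by
      refine (abs_measureReal_sub_le m _ _).trans ?_
      have hsub : (B' ∩ shift^[j] ⁻¹' C') ∆ (B ∩ shift^[j] ⁻¹' C)
          ⊆ (B' ∆ B) ∪ shift^[j] ⁻¹' (C' ∆ C) := by
        rintro x (⟨⟨h1, h2⟩, h3⟩ | ⟨⟨h1, h2⟩, h3⟩)
        · by_cases hx : x ∈ B
          · exact Or.inr (Or.inl ⟨h2, fun h => h3 ⟨hx, h⟩⟩)
          · exact Or.inl (Or.inl ⟨h1, hx⟩)
        · by_cases hx : x ∈ B'
          · exact Or.inr (Or.inr ⟨h2, fun h => h3 ⟨hx, h⟩⟩)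
          · exact Or.inl (Or.inr ⟨h1, hx⟩)
      have h2 := (measureReal_mono hsub).trans (measureReal_union_le (μ := m) _ _)
      rw [(hshift.iterate j).measureReal_preimage (hC'.symmDiff hC).nullMeasurableSet] at h2
      linarith
    have h2 : |m.real B' * m.real C' - m.real B * m.real C| ≤ ε / 8 := by
      have h3 := (abs_measureReal_sub_le m B' B).trans hBB.le
      have h4 := (abs_measureReal_sub_le m C' C).trans hCC.le
      have e : m.real B' * m.real C' - m.real B * m.real C
          = (m.real B' - m.real B) * m.real C' + m.real B * (m.real C' - m.real C) := by ring
      rw [e]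
      refine (abs_add_le _ _).trans ?_
      rw [abs_mul, abs_mul, abs_of_nonneg (measureReal_nonneg (s := C')),
        abs_of_nonneg (measureReal_nonneg (s := B))]
      have h5 := mul_le_mul h3 (measureReal_le_one (μ := m) (s := C')) measureReal_nonneg
        (by positivity)
      have h6 := mul_le_mul (measureReal_le_one (μ := m) (s := B)) h4 (abs_nonneg _) zero_le_one
      linarith
    have e : m.real (B ∩ shift^[j] ⁻¹' C) - m.real B * m.real C
        = (m.real (B' ∩ shift^[j] ⁻¹' C') - m.real B' * m.real C')
          - (m.real (B' ∩ shift^[j] ⁻¹' C') - m.real (B ∩ shift^[j] ⁻¹' C))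
          + (m.real B' * m.real C' - m.real B * m.real C) := by ring
    rw [e]
    refine (abs_add_le _ _).trans ?_
    have h3 := abs_sub (m.real (B' ∩ shift^[j] ⁻¹' C') - m.real B' * m.real C')
      (m.real (B' ∩ shift^[j] ⁻¹' C') - m.real (B ∩ shift^[j] ⁻¹' C))
    linarith
  refine ⟨n₀ + 1, fun n hn => ?_⟩
  have hn0 : (0 : ℝ) < n := by exact_mod_cast (by omega : 0 < n)
  have hn1 : (1 : ℝ) ≤ n := by exact_mod_cast (by omega : 1 ≤ n)
  rw [Real.dist_eq, sub_zero, abs_of_nonneg (mul_nonneg (by positivity)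
    (Finset.sum_nonneg fun _ _ => abs_nonneg _)), one_div, inv_mul_lt_iff₀ hn0]
  have h1 := Finset.sum_le_sum fun j (_ : j ∈ Finset.Icc 1 n) => hterm j
  rw [Finset.sum_add_distrib] at h1
  simp only [Finset.sum_const, Nat.card_Icc, Nat.add_sub_cancel, nsmul_eq_mul] at h1
  have h2 : ∑ j ∈ Finset.Icc 1 n, |m.real (B' ∩ shift^[j] ⁻¹' C') - m.real B' * m.real C'|
      ≤ ∑ j ∈ Finset.range (n + 1), |m.real (B' ∩ shift^[j] ⁻¹' C') - m.real B' * m.real C'| :=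
    Finset.sum_le_sum_of_subset_of_nonneg (fun j hj => by
      rw [Finset.mem_Icc] at hj; rw [Finset.mem_range]; omega) fun _ _ _ => abs_nonneg _
  have h3 := hn₀ (n + 1) (by omega)
  push_cast at h3
  have h4 := mul_le_mul_of_nonneg_left hn1 hε.le
  have h5 : 0 < n * ε := by positivity
  linarith

end ZeroEntropyProcess

theorem mainTheorem3 (b : ℕ → ℕ)
    (hb_pow : ∀ n : ℕ, 1 ≤ n → ∃ k : ℕ, b n = 2 ^ k)
    (hb_lim : Tendsto (fun n : ℕ => (b (n + 1) : ℝ) / ∏ i ∈ Finset.Icc 1 n, (b i : ℝ))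
      atTop atTop) :
    (∃! ν : ProbabilityMeasure ZeroEntropyProcess.Seq,
      ZeroEntropyProcess.HasCylinderValues b ν) ∧
    ∀ ν : ProbabilityMeasure ZeroEntropyProcess.Seq,
      ZeroEntropyProcess.HasCylinderValues b ν →
      ∃ μ : ProbabilityMeasure ZeroEntropyProcess.Seq,
        Tendsto (ZeroEntropyProcess.cesaro ν) atTop (𝓝 μ.toFiniteMeasure) ∧
        ZeroEntropyProcess.IsWeaklyMixing ZeroEntropyProcess.shift μ := by
  refine ⟨⟨ZeroEntropyProcess.process b, ZeroEntropyProcess.hasCylinderValues_process hb_pow,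
    fun ν hν => ZeroEntropyProcess.eq_process hb_pow hν⟩, fun ν hν => ?_⟩
  obtain rfl := ZeroEntropyProcess.eq_process hb_pow hν
  obtain ⟨μ, h1, h2⟩ := ZeroEntropyProcess.exists_tendsto_cesaro hb_pow
  exact ⟨μ, h1, ZeroEntropyProcess.isWeaklyMixing_of_tendsto hb_pow hb_lim h2⟩
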